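/- Let $K$ be a knotoid diagram in $S^2$, that is, a generic immersion of the unit interval in $S^2$ with finitely many transversal double points, each with over/under information; its two endpoints (tail and head) are distinct from the crossings. The standard torus representation $(T^2,\overline{K})$ of the virtual closure of $K$ is obtained as follows: cut out of $S^2$ two small disks around the endpoints of $K$, attach a handle (a cylinder) to the resulting annulus along its two boundary circles by orientation-reversing homeomorphisms, and join the endpoints of $K$ by an arc that runs once along the handle. Let $[\mu]\in H_1(T^2;\mathbb{Z})$ be the meridian, the class of the circle along which the handle is attached at the tail, and let a longitude be the class of a closed curve (1-cycle) that runs algebraically exactly once along the handle, in the direction from the head to the tail. A surface bracket state of $(T^2,\overline{K})$ is the collection of disjoint simple closed curves in $T^2$ that is obtained by smoothing each crossing of $\overline{K}$ in one of the two ways (type $A$ or type $B$). It is homologically nontrivial if one of its components is not null-homologous in $T^2$, and it has multiplicity one if exactly one of its components does not bound a disk in $T^2$. Longitudes exist, and for every longitude $[\lambda]$ the pair $[\lambda],[\mu]$ is a $\mathbb{Z}$-basis of $H_1(T^2;\mathbb{Z})$. Moreover, every homologically nontrivial surface bracket state of $(T^2,\overline{K})$ has multiplicity one, and the component that does not bound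 a disk has, with a suitable orientation, the class $[\lambda]+k[\mu]$ for some $k\in\mathbb{Z}$. -/

import Mathlib

/-- A finite cell decomposition of a closed oriented surface, given as a rotation system.  The elements
of `D` are the darts (half-edges, each pointing away from the vertex it is attached to); `next d` is
the dart that follows `d` counterclockwise around its vertex, and `flip d` is the other half of
the edge of `d`.  Vertices, edges and faces are the cycles of `next`, `flip` and `next * flip`. -/
structure CombMap (D : Type*) where
  next : Equiv.Perm D
  flip : Equiv.Perm D
  flip_flip : ∀ d, flip (flip d) = d
  flip_ne : ∀ d, flip d ≠ d

namespace CombMap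

variable {D : Type*} (M : CombMap D)

/-- The walk around a face: from `d`, run along the edge of `d` to its other end and leave along the
next dart there.  The face lies to the right of each of the darts on its boundary walk. -/
def turnFace : Equiv.Perm D := M.next * M.flip

def Vertex : Type _ := Quotient (Equiv.Perm.SameCycle.setoid M.next)
def Edge : Type _ := Quotient (Equiv.Perm.SameCycle.setoid M.flip)
def Face : Type _ := Quotient (Equiv.Perm.SameCycle.setoid M.turnFace)

/-- The vertex to which a dart is attached. -/
def vertexOf (d : D) : M.Vertex := Quotient.mk _ d
/-- The edge of a dart. -/
def edgeOf (d : D) : M.Edge := Quotient.mk _ d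
/-- The face to the right of a dart. -/
def faceOf (d : D) : M.Face := Quotient.mk _ d

/-- The surface is connected. -/
def Connected : Prop :=
  ∀ d e : D, e ∈ MulAction.orbit (Subgroup.closure ({M.next, M.flip} : Set (Equiv.Perm D))) d

noncomputable def eulerChar : ℤ :=
  (Nat.card M.Vertex : ℤ) - (Nat.card M.Edge : ℤ) + (Nat.card M.Face : ℤ)

/-- The closed oriented surface is a sphere: it is connected and has Euler characteristic two. -/
def IsSphere : Prop := M.Connected ∧ M.eulerChar = 2

theorem vertexOf_next (d : D) : M.vertexOf (M.next d) = M.vertexOf d :=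
  Quotient.sound (Equiv.Perm.sameCycle_apply_left.2 (Equiv.Perm.SameCycle.refl _ _))

theorem faceOf_flip (d : D) : M.faceOf (M.flip d) = M.faceOf (M.next d) := by
  refine Quotient.sound (show M.turnFace.SameCycle _ _ from ?_)
  have h : M.turnFace (M.flip d) = M.next d := by simp [turnFace, M.flip_flip]
  rw [← h]
  exact Equiv.Perm.sameCycle_apply_right.2 (Equiv.Perm.SameCycle.refl _ _)

section Homology

variable [Fintype D]

open Classical in
/-- Cellular 1-cycles with integer coefficients.  A 1-chain is a function `z` on darts with
`z (flip d) = - z d`, where `z d` is the coefficient of the edge of `d`, oriented along `d`; its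
boundary at the vertex of `d` is minus the sum of `z` over the darts at that vertex. -/
noncomputable def cycles : Submodule ℤ (D → ℤ) where
  carrier := {z | (∀ d, z (M.flip d) = - z d) ∧
    ∀ d, ∑ e with M.vertexOf e = M.vertexOf d, z e = 0}
  add_mem' := by
    rintro a b ⟨ha, ha'⟩ ⟨hb, hb'⟩
    refine ⟨fun d => ?_, fun d => ?_⟩
    · simp only [Pi.add_apply, ha, hb]; ring
    · simp only [Pi.add_apply, Finset.sum_add_distrib, ha', hb', add_zero]
  zero_mem' := by simp
  smul_mem' := by
    rintro c a ⟨ha, ha'⟩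
    refine ⟨fun d => ?_, fun d => ?_⟩
    · simp only [Pi.smul_apply, ha, smul_neg]
    · simp only [Pi.smul_apply, ← Finset.smul_sum, ha', smul_zero]

/-- The cellular boundary of 2-chains: the face to the right of `d` contributes its coefficient to
`d`, the one to the left of `d` contributes minus its coefficient. -/
noncomputable def boundary : (M.Face → ℤ) →ₗ[ℤ] M.cycles where
  toFun g := ⟨fun d => g (M.faceOf d) - g (M.faceOf (M.flip d)), by
    classical
    refine ⟨fun d => ?_, fun d => ?_⟩
    · simp only [M.flip_flip]; ring
    · simp only [Finset.sum_sub_distrib, faceOf_flip]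
      rw [sub_eq_zero]
      refine (Finset.sum_equiv M.next (fun e => ?_) (fun e _ => rfl)).symm
      simp [vertexOf_next]⟩
  map_add' a b := by
    ext d; simp only [Pi.add_apply, Submodule.coe_add]; ring
  map_smul' c a := by
    ext d; simp [mul_sub]

/-- First cellular homology of the surface, with integer coefficients. -/
abbrev H1 : Type _ := M.cycles ⧸ LinearMap.range M.boundary

/-- The homology class of a cycle. -/
noncomputable def homClass (z : M.cycles) : M.H1 := Submodule.Quotient.mk z

open Classical in
/-- The 1-cycle of an oriented closed curve in the 1-skeleton.  The curve leaves along the dart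
`d`; having run along a dart `e` it has arrived at the dart `flip e` and leaves along `p (flip e)`,
where `p` pairs up the darts at each vertex; it stops when it is back at `d`. -/
noncomputable def curve (p : Equiv.Perm D) (hp : ∀ e, M.vertexOf (p e) = M.vertexOf e) (d : D) :
    M.cycles :=
  ⟨fun e => (if (p * M.flip).SameCycle d e then 1 else 0) -
      (if (p * M.flip).SameCycle d (M.flip e) then 1 else 0), by
    refine ⟨fun e => ?_, fun v => ?_⟩
    · simp only [M.flip_flip]; ring
    · have h : ∀ e, (p * M.flip).SameCycle d (M.flip e) ↔ (p * M.flip).SameCycle d (p e) := by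
        intro e
        rw [← Equiv.Perm.sameCycle_apply_right (f := p * M.flip) (y := M.flip e)]
        simp [M.flip_flip]
      simp only [Finset.sum_sub_distrib, h]
      rw [sub_eq_zero]
      refine (Finset.sum_equiv p (fun e => ?_) (fun e _ => rfl)).symm
      simp [hp]⟩

end Homology

/-- For the set `S` of darts of a simple closed curve in the 1-skeleton (both darts of each of its
edges): `S` bounds a closed disk in the surface.  That is, there is a set `X` of faces such that the
edges of `S` are exactly those with `X` on one side only, and the region that `X` fills up (the
faces in `X` with the edges and vertices all of whose sides and corners lie in `X`) is connected
and has Euler characteristic one.  Adding the boundary circle, which has Euler characteristic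
zero, gives a compact connected surface with one boundary circle and Euler characteristic one. -/
def BoundsDisk (S : Set D) : Prop :=
  ∃ X : Set M.Face,
    (∀ d, d ∈ S ↔ ¬ (M.faceOf d ∈ X ↔ M.faceOf (M.flip d) ∈ X)) ∧
    (∀ f ∈ X, ∀ g ∈ X, Relation.ReflTransGen
      (fun a b => ∃ d, M.faceOf d = a ∧ M.faceOf (M.flip d) = b ∧ a ∈ X ∧ b ∈ X) f g) ∧
    (Nat.card {v : M.Vertex // ∀ d, M.vertexOf d = v → M.faceOf d ∈ X} : ℤ) -
      (Nat.card {e : M.Edge // ∀ d, M.edgeOf d = e → M.faceOf d ∈ X} : ℤ) +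
      (Nat.card {f : M.Face // f ∈ X} : ℤ) = 1

end CombMap

/-- The darts of a knotoid diagram with set of crossings `C`: four at each crossing, numbered
counterclockwise, with `0, 2` on the under-strand and `1, 3` on the over-strand, and one at each
endpoint (`false` for the tail and `true` for the head). -/
abbrev KDart (C : Type*) := (C × ZMod 4) ⊕ Bool

namespace KDart

variable {C : Type*}

/-- Counterclockwise rotation about the crossings. -/
def rotate : Equiv.Perm (KDart C) :=
  Equiv.sumCongr (Equiv.prodCongr (Equiv.refl C) (Equiv.addRight 1)) (Equiv.refl Bool)

/-- Going straight through each crossing; the endpoints are left alone. -/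
def straight : Equiv.Perm (KDart C) :=
  Equiv.sumCongr (Equiv.prodCongr (Equiv.refl C) (Equiv.addRight 2)) (Equiv.refl Bool)

end KDart

/-- A knotoid diagram in the oriented sphere, up to isotopy, with finite set of crossings `C`: the
crossings and the two endpoints are the vertices of a cell decomposition of the sphere whose edges
are the arcs of the diagram (`glue` sends each dart to the other half of its arc), and the path that
starts at the tail and goes straight through the crossings runs through the whole diagram. -/
structure KnotoidDiagram (C : Type*) where
  glue : Equiv.Perm (KDart C)
  glue_glue : ∀ d, glue (glue d) = d
  glue_ne : ∀ d, glue d ≠ d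
  one_strand : ∀ d : KDart C, d ∈ MulAction.orbit
    (Subgroup.closure ({glue, KDart.straight} : Set (Equiv.Perm (KDart C))))
    (Sum.inr false : KDart C)
  spherical : CombMap.IsSphere (D := KDart C) ⟨KDart.rotate, glue, glue_glue, glue_ne⟩

/-- The darts of the torus decomposition.  Its vertices are the crossings and two points `inr false`
(tail) and `inr true` (head), each with four darts numbered counterclockwise.  At the tail or the
head: `0` is the arc of the knotoid, `2` is the closing arc, which runs along the handle, and `1`
and `3` are the two ends of the circle along which the handle is attached there. -/
abbrev TDart (C : Type*) := (C ⊕ Bool) × ZMod 4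

namespace KnotoidDiagram

variable {C : Type*} (K : KnotoidDiagram C)

/-- A dart of the knotoid diagram, as a dart of the torus. -/
def toTorus : KDart C → TDart C
  | Sum.inl (c, i) => (Sum.inl c, i)
  | Sum.inr b => (Sum.inr b, 0)

/-- The edges of the torus decomposition: the arcs of the knotoid diagram; the closing arc, which
joins `(head, 2)` to `(tail, 2)`; and a loop at the tail and one at the head, which are the boundary
circles of the disks that are cut out around the endpoints. -/
def torusFlip : TDart C → TDart C
  | (Sum.inl c, i) => toTorus (K.glue (Sum.inl (c, i)))
  | (Sum.inr b, i) =>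
      if i = 0 then toTorus (K.glue (Sum.inr b))
      else if i = 2 then (Sum.inr (!b), 2)
      else (Sum.inr b, i + 2)

theorem torusFlip_toTorus (d : KDart C) : K.torusFlip (toTorus d) = toTorus (K.glue d) := by
  rcases d with ⟨c, i⟩ | b <;> simp [toTorus, torusFlip]

theorem toTorus_injective : Function.Injective (toTorus : KDart C → TDart C) := by
  rintro (⟨c, i⟩ | b) (⟨c', i'⟩ | b') h <;> simp_all [toTorus]

theorem tdart_cases (d : TDart C) : (∃ e, d = toTorus e) ∨
    (∃ b, d = (Sum.inr b, 1)) ∨ (∃ b, d = (Sum.inr b, 2)) ∨ (∃ b, d = (Sum.inr b, 3)) := by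
  obtain ⟨c | b, i⟩ := d
  · exact Or.inl ⟨Sum.inl (c, i), rfl⟩
  · have : ∀ i : ZMod 4, i = 0 ∨ i = 1 ∨ i = 2 ∨ i = 3 := by decide
    rcases this i with rfl | rfl | rfl | rfl
    · exact Or.inl ⟨Sum.inr b, rfl⟩
    · exact Or.inr (Or.inl ⟨b, rfl⟩)
    · exact Or.inr (Or.inr (Or.inl ⟨b, rfl⟩))
    · exact Or.inr (Or.inr (Or.inr ⟨b, rfl⟩))

theorem torusFlip_one (b : Bool) : K.torusFlip (Sum.inr b, 1) = (Sum.inr b, 3) := by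
  have h1 : (1 : ZMod 4) ≠ 0 := by decide
  have h2 : (1 : ZMod 4) ≠ 2 := by decide
  have h3 : (1 : ZMod 4) + 2 = 3 := by decide
  simp only [torusFlip, h1, h2, h3, if_false]

theorem torusFlip_two (b : Bool) : K.torusFlip (Sum.inr b, 2) = (Sum.inr (!b), 2) := by
  have h1 : (2 : ZMod 4) ≠ 0 := by decide
  simp only [torusFlip, h1, if_false, if_true]

theorem torusFlip_three (b : Bool) : K.torusFlip (Sum.inr b, 3) = (Sum.inr b, 1) := by
  have h1 : (3 : ZMod 4) ≠ 0 := by decide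
  have h2 : (3 : ZMod 4) ≠ 2 := by decide
  have h3 : (3 : ZMod 4) + 2 = 1 := by decide
  simp only [torusFlip, h1, h2, h3, if_false]

theorem torusFlip_torusFlip (d : TDart C) : K.torusFlip (K.torusFlip d) = d := by
  rcases tdart_cases d with ⟨e, rfl⟩ | ⟨b, rfl⟩ | ⟨b, rfl⟩ | ⟨b, rfl⟩
  · rw [torusFlip_toTorus, torusFlip_toTorus, K.glue_glue]
  · rw [torusFlip_one, torusFlip_three]
  · rw [torusFlip_two, torusFlip_two, Bool.not_not]
  · rw [torusFlip_three, torusFlip_one]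

theorem torusFlip_ne (d : TDart C) : K.torusFlip d ≠ d := by
  rcases tdart_cases d with ⟨e, rfl⟩ | ⟨b, rfl⟩ | ⟨b, rfl⟩ | ⟨b, rfl⟩
  · rw [torusFlip_toTorus]
    exact fun h => K.glue_ne e (toTorus_injective h)
  · rw [torusFlip_one]
    exact fun h => absurd (congrArg Prod.snd h) (show ¬ (3 : ZMod 4) = 1 by decide)
  · rw [torusFlip_two]
    intro h
    have := Sum.inr.inj (congrArg Prod.fst h)
    cases b <;> simp at this
  · rw [torusFlip_three]
    exact fun h => absurd (congrArg Prod.snd h) (show ¬ (1 : ZMod 4) = 3 by decide)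

/-- The standard torus representation of the virtual closure: disks around the endpoints are cut
out of the sphere and a handle (a cylinder) is attached to the resulting annulus.  The closing
arc runs along the handle and cuts it into one square face; the other faces are those of
the sphere, where the ones at the endpoints are now bounded by the attaching circles as well. -/
def torus : CombMap (TDart C) where
  next := Equiv.prodCongr (Equiv.refl _) (Equiv.addRight 1)
  flip := Function.Involutive.toPerm K.torusFlip K.torusFlip_torusFlip
  flip_flip := K.torusFlip_torusFlip
  flip_ne := K.torusFlip_ne

theorem torus_vertexOf (v : C ⊕ Bool) (i j : ZMod 4) :
    K.torus.vertexOf (v, i) = K.torus.vertexOf (v, j) := by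
  have h1 : ∀ k : ZMod 4, K.torus.vertexOf (v, k + 1) = K.torus.vertexOf (v, k) :=
    fun k => K.torus.vertexOf_next (v, k)
  have h2 : ∀ n : ℕ, K.torus.vertexOf (v, (n : ZMod 4)) = K.torus.vertexOf (v, 0) := by
    intro n
    induction n with
    | zero => simp
    | succ n ih => rw [Nat.cast_succ, h1, ih]
  rw [← ZMod.natCast_zmod_val i, ← ZMod.natCast_zmod_val j, h2, h2]

/-- The dart belongs to the knot in the torus, which consists of the knotoid and the closing arc. -/
def IsKnotDart : TDart C → Prop
  | (Sum.inl _, _) => True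
  | (Sum.inr _, i) => i = 0 ∨ i = 2

end KnotoidDiagram

/-- A choice of smoothing at each crossing: `true` is the A-smoothing, `false` the B-smoothing. -/
abbrev BracketState (C : Type*) := C → Bool

namespace BracketState

variable {C : Type*} (s : BracketState C)

/-- The smoothing at `c` joins the dart `shift` to `shift + 1` and `shift + 2` to `shift + 3`.  Turning
the over-strand (darts `1, 3`) counterclockwise sweeps out the corners from `1` to `2` and from `3`
to `0`.  The A-smoothing merges these two, so it joins `0` to `1` and `2` to `3`; the B-smoothing
joins `1` to `2` and `3` to `0`. -/
def shift (c : C) : ZMod 4 := if s c then 0 else 1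

/-- How the state curves go on at each vertex: by the smoothing at a crossing, straight on at the tail
and the head. -/
def turnFun : TDart C → TDart C
  | (Sum.inl c, i) =>
      (Sum.inl c, if i = s.shift c ∨ i = s.shift c + 2 then i + 1 else i - 1)
  | (Sum.inr b, i) => (Sum.inr b, i + 2)

theorem turnFun_turnFun (d : TDart C) : s.turnFun (s.turnFun d) = d := by
  obtain ⟨c | b, i⟩ := d
  · have h : ∀ o i : ZMod 4, (if (if i = o ∨ i = o + 2 then i + 1 else i - 1) = o ∨
        (if i = o ∨ i = o + 2 then i + 1 else i - 1) = o + 2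
        then (if i = o ∨ i = o + 2 then i + 1 else i - 1) + 1
        else (if i = o ∨ i = o + 2 then i + 1 else i - 1) - 1) = i := by decide
    exact congrArg (Prod.mk (Sum.inl c)) (h (s.shift c) i)
  · have h : ∀ i : ZMod 4, i + 2 + 2 = i := by decide
    exact congrArg (Prod.mk (Sum.inr b)) (h i)

def turn : Equiv.Perm (TDart C) := Function.Involutive.toPerm s.turnFun s.turnFun_turnFun

/-- The darts at the vertices of the smoothed diagram.  Each crossing `c` is pulled apart into two
vertices, each on one of the two arcs of the smoothing, which remain joined by a new edge with darts
`inr (c, false)` and `inr (c, true)` that crosses the merged region. -/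
abbrev Dart (C : Type*) := TDart C ⊕ (C × Bool)

def rotateFun : Dart C → Dart C
  | Sum.inl (Sum.inl c, i) =>
      if i = s.shift c + 1 then Sum.inr (c, false)
      else if i = s.shift c + 3 then Sum.inr (c, true)
      else Sum.inl (Sum.inl c, i + 1)
  | Sum.inl (Sum.inr b, i) => Sum.inl (Sum.inr b, i + 1)
  | Sum.inr (c, b) => Sum.inl (Sum.inl c, if b then s.shift c + 2 else s.shift c)

def rotateInv : Dart C → Dart C
  | Sum.inl (Sum.inl c, i) =>
      if i = s.shift c then Sum.inr (c, false)
      else if i = s.shift c + 2 then Sum.inr (c, true)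
      else Sum.inl (Sum.inl c, i - 1)
  | Sum.inl (Sum.inr b, i) => Sum.inl (Sum.inr b, i - 1)
  | Sum.inr (c, b) => Sum.inl (Sum.inl c, if b then s.shift c + 3 else s.shift c + 1)

/-- Counterclockwise rotation about the vertices of the smoothed diagram: `shift`, `shift + 1`, new dart
at the one vertex, and `shift + 2`, `shift + 3`, new dart at the other. -/
def rotate : Equiv.Perm (Dart C) where
  toFun := s.rotateFun
  invFun := s.rotateInv
  left_inv := by
    have h20 : (2 : ZMod 4) ≠ 0 := by decide
    have h : ∀ o i : ZMod 4, i ≠ o + 1 → i ≠ o + 3 → i + 1 ≠ o ∧ i + 1 ≠ o + 2 := by decide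
    rintro (⟨c | b, i⟩ | ⟨c, b⟩)
    · by_cases h1 : i = s.shift c + 1
      · simp [rotateFun, rotateInv, h1]
      · by_cases h3 : i = s.shift c + 3
        · subst h3
          simp [rotateFun, rotateInv, h1]
        · obtain ⟨h4, h5⟩ := h (s.shift c) i h1 h3
          simp [rotateFun, rotateInv, h1, h3, h4, h5]
    · simp [rotateFun, rotateInv]
    · cases b <;> simp [rotateFun, rotateInv, h20]
  right_inv := by
    have h31 : (3 : ZMod 4) ≠ 1 := by decide
    have h : ∀ o i : ZMod 4, i ≠ o → i ≠ o + 2 → i - 1 ≠ o + 1 ∧ i - 1 ≠ o + 3 := by decide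
    rintro (⟨c | b, i⟩ | ⟨c, b⟩)
    · by_cases h1 : i = s.shift c
      · simp [rotateFun, rotateInv, h1]
      · by_cases h3 : i = s.shift c + 2
        · subst h3
          simp [rotateFun, rotateInv, h1]
        · obtain ⟨h4, h5⟩ := h (s.shift c) i h1 h3
          simp [rotateFun, rotateInv, h1, h3, h4, h5]
    · simp [rotateFun, rotateInv]
    · cases b <;> simp [rotateFun, rotateInv, h31]

end BracketState

namespace KnotoidDiagram

variable {C : Type*} (K : KnotoidDiagram C) (s : BracketState C)

/-- The decomposition of the same torus in which the state curves are pairwise disjoint simple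
closed curves in the 1-skeleton.  Contracting the new edges gives back `K.torus`. -/
def stateMap : CombMap (BracketState.Dart C) where
  next := s.rotate
  flip := Equiv.sumCongr K.torus.flip (Equiv.prodCongr (Equiv.refl C) Equiv.boolNot)
  flip_flip := by
    rintro (d | ⟨c, b⟩)
    · simp [K.torus.flip_flip]
    · simp
  flip_ne := by
    rintro (d | ⟨c, b⟩)
    · simpa using K.torus.flip_ne d
    · simp

/-- The components of the surface bracket state, each given as the set of all its darts. -/
def stateComponents : Set (Set (TDart C)) :=
  {S | ∃ d, IsKnotDart d ∧ S = MulAction.orbit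
    (Subgroup.closure ({K.torus.flip, s.turn} : Set (Equiv.Perm (TDart C)))) d}

/-- The component bounds a disk in the torus. -/
def ComponentBoundsDisk (S : Set (TDart C)) : Prop :=
  (K.stateMap s).BoundsDisk (Sum.inl '' S)

theorem vertexOf_turn (d : TDart C) : K.torus.vertexOf (s.turn d) = K.torus.vertexOf d := by
  obtain ⟨c | b, i⟩ := d <;> exact K.torus_vertexOf _ _ _

section Homology

variable [Fintype C]

/-- The homology class in the torus of the component that runs through the dart `d`, oriented in the
direction of `d`. -/
noncomputable def componentClass (d : TDart C) : K.torus.H1 :=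
  K.torus.homClass (K.torus.curve s.turn (K.vertexOf_turn s) d)

/-- The surface bracket state has a component that is not null-homologous. -/
def HomologicallyNontrivial : Prop := ∃ d, IsKnotDart d ∧ K.componentClass s d ≠ 0

/-- The meridian: the class of the circle along which the handle is attached at the tail. -/
noncomputable def meridian : K.torus.H1 :=
  K.torus.homClass (K.torus.curve (Equiv.prodCongr (Equiv.refl _) (Equiv.addRight 2))
    (fun _ => K.torus_vertexOf _ _ _) (Sum.inr false, 1))

/-- A longitude: the class of a cycle that runs exactly once along the handle, in the
direction from the head to the tail (the coefficient of the closing arc is the intersection number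
with the belt circle of the handle). -/
def IsLongitude (l : K.torus.H1) : Prop :=
  ∃ z : K.torus.cycles, K.torus.homClass z = l ∧ z.1 (Sum.inr true, 2) = 1

end Homology

/-- Exactly one component of the surface bracket state does not bound a disk in the torus. -/
def MultiplicityOne : Prop :=
  ∃! S, S ∈ K.stateComponents s ∧ ¬ K.ComponentBoundsDisk s S

end KnotoidDiagram

/-! The component of a state that contains the closing arc (the long component) decides everything.
It runs along the handle exactly once, because the closing arc is a single edge and a state curve
never retraces an edge. Hence its cycle differs from any longitude by a cycle with coefficient zero
on the closing arc, and such a cycle is homologous to a multiple of the meridian. The long component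
bounds no disk, since the square on the handle lies on both sides of the closing arc. It remains to
see that every other component bounds a disk.

Homology is handled by counting cells. Over ℚ, closed chains are orthogonal to coboundaries, so
independent families of both kinds cannot exceed the number of edges, and if they reach it they span
(`CombMap.card_add_card_le`). On the torus the count is sharp: the meridian, one long curve and the
face boundaries span all cycles. Integrality follows because the faces stay connected when the
circle at the tail may not be crossed (`exists_eq_meridian_add_boundary`).

Let a component other than the long one have the cycle `k` times the meridian plus the boundary of a
2-chain `g`. The number `k` is, up to sign, the jump of `g` across the circle at the tail. The long
component is disjoint from the given one, so `g` can be followed along it without change from the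
tail to the head, and across the circle at the head there is no jump; thus `k = 0`
(`eq_at_tail_of_eq_along_longComponent`). The component therefore separates the torus. Let `X` be
the side without the square. Counting gives Euler characteristic at most 1 for `X`, and at most -1
for the other side, which carries the independent cycles of the meridian and the long component. The
boundary circle contributes nothing and the torus has Euler characteristic 0, so both bounds are
equalities and `X` is an open disk (`card_side`). -/

/-! ### Orthogonal subspaces over ℚ -/

/-- The dot product is positive definite over ℚ, so orthogonal subspaces meet only in zero. If their
dimensions add up to that of `P` they sum to `P`, and a vector of `P` orthogonal to `W` has no
component in `W`. -/
theorem Submodule.finrank_add_finrank_le_of_dotProduct {D : Type*} [Fintype D]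
    {P U W : Submodule ℚ (D → ℚ)} (hU : U ≤ P) (hW : W ≤ P)
    (h : ∀ u ∈ U, ∀ w ∈ W, u ⬝ᵥ w = 0) :
    Module.finrank ℚ U + Module.finrank ℚ W ≤ Module.finrank ℚ P ∧
    (Module.finrank ℚ P ≤ Module.finrank ℚ U + Module.finrank ℚ W →
      ∀ z ∈ P, (∀ w ∈ W, z ⬝ᵥ w = 0) → z ∈ U) := by
  have hinf : U ⊓ W = ⊥ := by
    rw [Submodule.eq_bot_iff]
    rintro x ⟨hx, hx'⟩
    exact dotProduct_self_eq_zero.1 (h x hx x hx')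
  have hsum := Submodule.finrank_sup_add_finrank_inf_eq U W
  rw [hinf, finrank_bot, add_zero] at hsum
  have hle : U ⊔ W ≤ P := sup_le hU hW
  refine ⟨hsum ▸ Submodule.finrank_mono hle, fun hP z hz hzW => ?_⟩
  rw [← hsum] at hP
  have heq : U ⊔ W = P := Submodule.eq_of_le_of_finrank_le hle hP
  rw [← heq] at hz
  obtain ⟨u, hu, w, hw, rfl⟩ := Submodule.mem_sup.1 hz
  have h1 := hzW w hw
  rw [add_dotProduct, h u hu w hw, zero_add] at h1
  rw [dotProduct_self_eq_zero.1 h1, add_zero]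
  exact hu

/-! ### Rational chains on a combinatorial map and the counting inequality -/

namespace CombMap

variable {D : Type*} (M : CombMap D)

theorem edgeOf_flip (d : D) : M.edgeOf (M.flip d) = M.edgeOf d :=
  Quotient.sound (Equiv.Perm.sameCycle_apply_left.2 (Equiv.Perm.SameCycle.refl _ _))

theorem edgeOf_eq_iff {d e : D} : M.edgeOf d = M.edgeOf e ↔ e = d ∨ e = M.flip d := by
  constructor
  · intro h
    obtain ⟨n, hn⟩ : M.flip.SameCycle d e := Quotient.exact h
    have h2 : M.flip ^ 2 = 1 := by ext x; simp [pow_two, M.flip_flip]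
    rcases Int.even_or_odd' n with ⟨m, rfl | rfl⟩
    · left
      rw [zpow_mul] at hn
      norm_cast at hn
      simpa [h2] using hn.symm
    · right
      rw [zpow_add, zpow_mul] at hn
      norm_cast at hn
      simpa [h2] using hn.symm
  · rintro (rfl | rfl)
    · rfl
    · rw [edgeOf_flip]

-- Connectedness is used only in this form: to compare values at two darts it suffices to check the
-- two generators.
variable {M} in
theorem Connected.const (hM : M.Connected) {α : Type*} {f : D → α}
    (hn : ∀ d, f (M.next d) = f d) (hf : ∀ d, f (M.flip d) = f d) (d e : D) : f d = f e := by
  obtain ⟨⟨g, hg⟩, rfl⟩ := hM d e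
  symm
  change f (g d) = f d
  induction hg using Subgroup.closure_induction generalizing d with
  | mem x hx => rcases hx with rfl | rfl <;> simp [hn, hf]
  | one => rfl
  | mul x y _ _ hx hy => rw [Equiv.Perm.mul_apply, hx, hy]
  | inv x _ hx => rw [← hx (x⁻¹ d)]; simp

instance [Finite D] : Finite M.Vertex := Quotient.finite _
instance [Finite D] : Finite M.Edge := Quotient.finite _
instance [Finite D] : Finite M.Face := Quotient.finite _

theorem two_mul_card_edge [Fintype D] : 2 * Nat.card M.Edge = Nat.card D := by
  classical
  have : Fintype M.Edge := Fintype.ofFinite _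
  rw [Nat.card_eq_fintype_card, Nat.card_eq_fintype_card, ← Finset.card_univ (α := D),
    Finset.card_eq_sum_card_fiberwise (f := M.edgeOf) (t := Finset.univ) (by simp)]
  rw [Finset.sum_const_nat (m := 2), Finset.card_univ, mul_comm]
  intro e _
  obtain ⟨d, rfl⟩ := Quotient.exists_rep e
  have : Finset.univ.filter (fun x => M.edgeOf x = M.edgeOf d) = {d, M.flip d} := by
    ext x
    rw [Finset.mem_filter, eq_comm, edgeOf_eq_iff]
    simp
  exact (congrArg Finset.card this).trans (Finset.card_pair (M.flip_ne d).symm)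

/-- The set of vertices all of whose corners lie in `X`. -/
def innerVertices (X : Set M.Face) : Set M.Vertex := {v | ∀ d, M.vertexOf d = v → M.faceOf d ∈ X}

/-- The set of edges both sides of which lie in `X`. -/
def innerEdges (X : Set M.Face) : Set M.Edge := {e | ∀ d, M.edgeOf d = e → M.faceOf d ∈ X}

theorem edgeOf_mem_innerEdges {X : Set M.Face} {d : D} :
    M.edgeOf d ∈ M.innerEdges X ↔ M.faceOf d ∈ X ∧ M.faceOf (M.flip d) ∈ X := by
  constructor
  · exact fun h => ⟨h d rfl, h _ (M.edgeOf_flip d)⟩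
  · rintro ⟨h1, h2⟩ e he
    rcases M.edgeOf_eq_iff.1 he.symm with rfl | rfl <;> assumption

/-- The boundary of a rational 2-chain. -/
def bdry : (M.Face → ℚ) →ₗ[ℚ] (D → ℚ) where
  toFun g d := g (M.faceOf d) - g (M.faceOf (M.flip d))
  map_add' a b := by ext d; simp only [Pi.add_apply]; ring
  map_smul' c a := by ext d; simp [mul_sub]

/-- The coboundary of a rational 0-cochain. -/
def cobdry : (M.Vertex → ℚ) →ₗ[ℚ] (D → ℚ) where
  toFun f d := f (M.vertexOf d) - f (M.vertexOf (M.flip d))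
  map_add' a b := by ext d; simp only [Pi.add_apply]; ring
  map_smul' c a := by ext d; simp [mul_sub]

theorem bdry_apply (g : M.Face → ℚ) (d : D) :
    M.bdry g d = g (M.faceOf d) - g (M.faceOf (M.flip d)) := rfl

theorem cobdry_apply (g : M.Vertex → ℚ) (d : D) :
    M.cobdry g d = g (M.vertexOf d) - g (M.vertexOf (M.flip d)) := rfl

/-- Rational 1-chains supported on a set of edges. -/
def chains (E : Set M.Edge) : Submodule ℚ (D → ℚ) where
  carrier := {z | (∀ d, z (M.flip d) = - z d) ∧ ∀ d, M.edgeOf d ∉ E → z d = 0}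
  add_mem' := by
    rintro a b ⟨ha, ha'⟩ ⟨hb, hb'⟩
    refine ⟨fun d => ?_, fun d h => ?_⟩
    · simp only [Pi.add_apply, ha, hb]; ring
    · simp [ha' d h, hb' d h]
  zero_mem' := by simp
  smul_mem' := by
    rintro c a ⟨ha, ha'⟩
    refine ⟨fun d => ?_, fun d h => ?_⟩
    · simp [ha]
    · simp [ha' d h]

theorem finrank_chains_le [Finite D] (E : Set M.Edge) :
    Module.finrank ℚ (M.chains E) ≤ Nat.card E := by
  classical
  have : Fintype E := Fintype.ofFinite _
  let r : M.chains E →ₗ[ℚ] (E → ℚ) :=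
    { toFun := fun z e => z.1 e.1.out
      map_add' := fun _ _ => rfl
      map_smul' := fun _ _ => rfl }
  have hr : Function.Injective r := by
    rw [← LinearMap.ker_eq_bot, LinearMap.ker_eq_bot']
    intro z hz
    ext d
    by_cases hd : M.edgeOf d ∈ E
    · have h1 : z.1 (M.edgeOf d).out = 0 := congrFun hz ⟨_, hd⟩
      have h2 : M.edgeOf (M.edgeOf d).out = M.edgeOf d := Quotient.out_eq _
      rcases M.edgeOf_eq_iff.1 h2 with h | h
      · rw [h]; exact h1
      · rw [h, z.2.1, h1]; simp
    · exact z.2.2 d hd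
  have := LinearMap.finrank_le_finrank_of_injective hr
  rwa [Module.finrank_fintype_fun_eq_card, ← Nat.card_eq_fintype_card] at this

theorem bdry_flip (g : M.Face → ℚ) (d : D) : M.bdry g (M.flip d) = - M.bdry g d := by
  simp only [bdry_apply, M.flip_flip]; ring

variable [Fintype D]

open Classical in
/-- The boundary of the 1-chain `z` vanishes. -/
def IsClosed (z : D → ℚ) : Prop := ∀ d, ∑ e with M.vertexOf e = M.vertexOf d, z e = 0

variable {M}

theorem IsClosed.sum_mul_eq_zero {z : D → ℚ} (hz : M.IsClosed z) (f : M.Vertex → ℚ) :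
    ∑ d, z d * f (M.vertexOf d) = 0 := by
  classical
  have : Fintype M.Vertex := Fintype.ofFinite _
  rw [← Finset.sum_fiberwise (s := Finset.univ) (g := M.vertexOf)]
  refine Finset.sum_eq_zero fun v _ => ?_
  obtain ⟨d, rfl⟩ := Quotient.exists_rep v
  have h := hz d
  change ∑ i with M.vertexOf i = M.vertexOf d, _ = 0
  rw [Finset.sum_congr rfl (g := fun i => z i * f (M.vertexOf d)), ← Finset.sum_mul]
  · rw [show (∑ i with M.vertexOf i = M.vertexOf d, z i) = 0 by convert h, zero_mul]
  · intro i hi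
    rw [(Finset.mem_filter.1 hi).2]

/-- Summation by parts: the boundary is adjoint to the coboundary up to a factor, and the boundary
of `z` vanishes. -/
theorem IsClosed.dotProduct_cobdry {z : D → ℚ} (hz : M.IsClosed z)
    (hz' : ∀ d, z (M.flip d) = - z d) (f : M.Vertex → ℚ) : z ⬝ᵥ M.cobdry f = 0 := by
  have h1 : z ⬝ᵥ M.cobdry f = ∑ d, z d * f (M.vertexOf d)
      - ∑ d, z d * f (M.vertexOf (M.flip d)) := by
    simp [dotProduct, cobdry_apply, mul_sub, Finset.sum_sub_distrib]
  have h2 : ∑ d, z d * f (M.vertexOf (M.flip d)) = ∑ d, - z d * f (M.vertexOf d) := by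
    refine Fintype.sum_equiv M.flip _ _ fun d => ?_
    rw [hz', neg_neg]
  rw [h1, h2]
  simp only [neg_mul, Finset.sum_neg_distrib]
  rw [hz.sum_mul_eq_zero]
  simp

theorem isClosed_bdry (g : M.Face → ℚ) : M.IsClosed (M.bdry g) := by
  classical
  intro d
  simp only [bdry_apply, Finset.sum_sub_distrib, faceOf_flip]
  rw [sub_eq_zero]
  refine (Finset.sum_equiv M.next (fun e => ?_) (fun e _ => rfl)).symm
  simp [vertexOf_next]

/-- Functions supported on `A`. -/
noncomputable def extendZero {α : Type*} (A : Set α) : (A → ℚ) →ₗ[ℚ] (α → ℚ) :=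
  Function.ExtendByZero.linearMap ℚ Subtype.val

theorem extendZero_apply {α : Type*} {A : Set α} (f : A → ℚ) (a : A) :
    extendZero A f a = f a := Subtype.val_injective.extend_apply _ _ _

theorem extendZero_of_notMem {α : Type*} {A : Set α} (f : A → ℚ) {a : α} (ha : a ∉ A) :
    extendZero A f a = 0 :=
  Function.extend_apply' _ _ _ (by rintro ⟨b, rfl⟩; exact ha b.2)

/-- Inside the chains on `E`, whose dimension is at most the number of edges, the coboundaries from
`A` are orthogonal to the span of the face boundaries from `B`, cut off to `E`, and the cycles `c
i`. The injectivity hypotheses turn the dimensions into cardinalities. The inequality bounds Euler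
characteristics; its equality case computes homology. -/
theorem card_add_card_le {n : ℕ} {E : Set M.Edge} {A : Set M.Vertex} {B : Set M.Face}
    {c : Fin n → D → ℚ} (hA : ∀ d, M.vertexOf d ∈ A → M.edgeOf d ∈ E)
    (hc : ∀ i, c i ∈ M.chains E) (hc' : ∀ i, M.IsClosed (c i))
    (hinjA : ∀ f : M.Vertex → ℚ, (∀ v ∉ A, f v = 0) → M.cobdry f = 0 → f = 0)
    (hinjB : ∀ (g : M.Face → ℚ) (a : Fin n → ℚ), (∀ x ∉ B, g x = 0) →
      (∀ d, M.edgeOf d ∈ E → M.bdry g d + ∑ i, a i * c i d = 0) → g = 0 ∧ a = 0) :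
    Nat.card B + n + Nat.card A ≤ Nat.card E ∧
    (Nat.card E ≤ Nat.card B + n + Nat.card A → ∀ z ∈ M.chains E, M.IsClosed z →
      ∃ (g : M.Face → ℚ) (a : Fin n → ℚ), ∀ d, M.edgeOf d ∈ E →
        z d = M.bdry g d + ∑ i, a i * c i d) := by
  classical
  have : Fintype A := Fintype.ofFinite _
  have : Fintype B := Fintype.ofFinite _
  let res : (D → ℚ) →ₗ[ℚ] (D → ℚ) :=
    { toFun := fun z d => if M.edgeOf d ∈ E then z d else 0
      map_add' := fun x y => by ext d; by_cases h : M.edgeOf d ∈ E <;> simp [h]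
      map_smul' := fun x y => by ext d; by_cases h : M.edgeOf d ∈ E <;> simp [h] }
  have hres : ∀ z d, res z d = if M.edgeOf d ∈ E then z d else 0 := fun _ _ => rfl
  let w : (A → ℚ) →ₗ[ℚ] (D → ℚ) := M.cobdry ∘ₗ extendZero A
  let u : ((B → ℚ) × (Fin n → ℚ)) →ₗ[ℚ] (D → ℚ) :=
    res ∘ₗ (LinearMap.coprod (M.bdry ∘ₗ extendZero B) (Fintype.linearCombination ℚ c))
  have hu : ∀ g a d, u (g, a) d =
      if M.edgeOf d ∈ E then M.bdry (extendZero B g) d + ∑ i, a i * c i d else 0 := by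
    intro g a d
    simp [u, hres, Fintype.linearCombination_apply]
  have hw : Function.Injective w := by
    rw [← LinearMap.ker_eq_bot, LinearMap.ker_eq_bot']
    intro f hf
    have := hinjA (extendZero A f) (fun v hv => extendZero_of_notMem f hv) hf
    ext v
    rw [← extendZero_apply f v, this]
    rfl
  have hu' : Function.Injective u := by
    rw [← LinearMap.ker_eq_bot, LinearMap.ker_eq_bot']
    rintro ⟨g, a⟩ hg
    have := hinjB (extendZero B g) a (fun v hv => extendZero_of_notMem g hv) (fun d hd => by
      have := congrFun hg d
      rwa [hu, if_pos hd] at this)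
    refine Prod.ext ?_ this.2
    ext v
    exact (extendZero_apply g v).symm.trans (congrFun this.1 v)
  have hwP : LinearMap.range w ≤ M.chains E := by
    rintro _ ⟨f, rfl⟩
    refine ⟨fun d => ?_, fun d hd => ?_⟩
    · simp only [w, LinearMap.comp_apply, cobdry_apply, M.flip_flip]; ring
    · have h1 : M.vertexOf d ∉ A := fun h => hd (hA d h)
      have h2 : M.vertexOf (M.flip d) ∉ A := fun h => hd (M.edgeOf_flip d ▸ hA _ h)
      simp [w, cobdry_apply, extendZero_of_notMem _ h1, extendZero_of_notMem _ h2]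
  have huP : LinearMap.range u ≤ M.chains E := by
    rintro _ ⟨⟨g, a⟩, rfl⟩
    refine ⟨fun d => ?_, fun d hd => by rw [hu, if_neg hd]⟩
    rw [hu, hu, edgeOf_flip, bdry_flip]
    split_ifs
    · simp only [(hc _).1, mul_neg, Finset.sum_neg_distrib]; ring
    · simp
  have horth : ∀ x ∈ LinearMap.range u, ∀ y ∈ LinearMap.range w, x ⬝ᵥ y = 0 := by
    rintro _ ⟨⟨g, a⟩, rfl⟩ y hy
    have hy' := (hwP hy).2
    obtain ⟨f, rfl⟩ := hy
    -- A boundary cut off to `E` need not be closed, but `w f` vanishes outside `E`, so the product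
    -- is that of the full boundary.
    have h1 : u (g, a) ⬝ᵥ w f = M.bdry (extendZero B g) ⬝ᵥ w f + ∑ i, a i * (c i ⬝ᵥ w f) := by
      simp only [dotProduct, Finset.mul_sum]
      rw [Finset.sum_comm, ← Finset.sum_add_distrib]
      refine Finset.sum_congr rfl fun d _ => ?_
      rw [hu]
      split_ifs with hd
      · rw [add_mul, Finset.sum_mul]
        simp only [mul_assoc]
      · simp [hy' d hd]
    rw [h1]
    simp only [w, LinearMap.comp_apply]
    rw [(isClosed_bdry _).dotProduct_cobdry (M.bdry_flip _)]
    simp [fun i => (hc' i).dotProduct_cobdry (hc i).1]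
  obtain ⟨h1, h2⟩ := Submodule.finrank_add_finrank_le_of_dotProduct huP hwP horth
  have hE := M.finrank_chains_le E
  rw [LinearMap.finrank_range_of_inj hw, LinearMap.finrank_range_of_inj hu',
    Module.finrank_prod, Module.finrank_fintype_fun_eq_card, Module.finrank_fintype_fun_eq_card,
    Module.finrank_fintype_fun_eq_card, Fintype.card_fin, ← Nat.card_eq_fintype_card,
    ← Nat.card_eq_fintype_card] at h1 h2
  refine ⟨h1.trans hE, fun h z hz hz' => ?_⟩
  obtain ⟨⟨g, a⟩, hg⟩ := h2 (hE.trans h) z hz (by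
    rintro _ ⟨f, rfl⟩
    exact hz'.dotProduct_cobdry hz.1 _)
  exact ⟨_, a, fun d hd => by rw [← hg, hu, if_pos hd]⟩

end CombMap

/-! ### Cycles of a product of two involutions -/

/-- Two fixed-point-free involutions generate an action in which the orbits of the product do not
meet their mirror images. -/
theorem Equiv.Perm.not_sameCycle_of_involutions {D : Type*} {p f : Equiv.Perm D}
    (hp : ∀ d, p (p d) = d) (hp' : ∀ d, p d ≠ d) (hf : ∀ d, f (f d) = d) (hf' : ∀ d, f d ≠ d)
    (d : D) : ¬ (p * f).SameCycle d (f d) := by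
  have hff : f * f = 1 := by ext x; simp [hf]
  have hpp : p * p = 1 := by ext x; simp [hp]
  have key : ∀ m : ℤ, f * (p * f) ^ m = (p * f) ^ (-m) * f := by
    intro m
    have h1 : f * (p * f) * f⁻¹ = (p * f)⁻¹ := by
      rw [mul_inv_rev, inv_eq_of_mul_eq_one_right hff, inv_eq_of_mul_eq_one_right hpp]
      simp [mul_assoc, hff]
    rw [zpow_neg, ← inv_zpow, ← h1, conj_zpow]
    simp [mul_assoc]
  rintro ⟨n, hn⟩
  -- By the dihedral relation `key`, halving the exponent moves the coincidence to the middle of the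
  -- walk: an even exponent gives a fixed point of `f`, an odd one a fixed point of `p`.
  rcases Int.even_or_odd' n with ⟨m, rfl | rfl⟩
  · refine hf' (((p * f) ^ m) d) ?_
    have := congrArg ((p * f) ^ (-m)) hn
    rw [← Equiv.Perm.mul_apply, ← Equiv.Perm.mul_apply, ← zpow_add, ← key] at this
    rw [← Equiv.Perm.mul_apply, ← this]
    congr 2; ring
  · refine hp' (f (((p * f) ^ m) d)) ?_
    have := congrArg ((p * f) ^ (-m)) hn
    rw [← Equiv.Perm.mul_apply, ← Equiv.Perm.mul_apply, ← zpow_add, ← key] at this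
    rw [show -m + (2 * m + 1) = 1 + m by ring, zpow_one_add] at this
    exact this

theorem Equiv.Perm.SameCycle.map_eq {D α : Type*} {p : Equiv.Perm D} {f : D → α}
    (h : ∀ d, f (p d) = f d) {d e : D} (hde : p.SameCycle d e) : f d = f e := by
  obtain ⟨n, rfl⟩ := hde
  induction n using Int.induction_on with
  | zero => rfl
  | succ n ih => rw [add_comm, zpow_one_add, Equiv.Perm.mul_apply, h, ih]
  | pred n ih =>
    rw [ih, ← h ((p ^ (-(n : ℤ) - 1)) d), ← Equiv.Perm.mul_apply, ← zpow_one_add]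
    congr 3; ring

/-! ### Vertices and faces through invariant labels -/

namespace CombMap

variable {D : Type*} (M : CombMap D)

/-- Vertices are classified by a rotation-invariant label. -/
def vertexEquiv {α : Type*} (f : D → α) (sec : α → D) (h : ∀ d, f (M.next d) = f d)
    (h1 : ∀ a, f (sec a) = a) (h2 : ∀ d, M.vertexOf (sec (f d)) = M.vertexOf d) :
    M.Vertex ≃ α where
  toFun := Quotient.lift f fun _ _ hde => Equiv.Perm.SameCycle.map_eq h hde
  invFun a := M.vertexOf (sec a)
  left_inv := by rintro ⟨d⟩; exact h2 d
  right_inv a := h1 a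

/-- A function of the faces from a function of their corners. -/
def faceLift {α : Type*} (f : D → α) (h : ∀ d, f (M.next d) = f (M.flip d)) : M.Face → α :=
  Quotient.lift f fun _ _ hde => Equiv.Perm.SameCycle.map_eq (p := M.turnFace)
    (fun d => by rw [turnFace, Equiv.Perm.mul_apply, h, M.flip_flip]) hde

theorem faceOf_next (d : D) : M.faceOf (M.next d) = M.faceOf (M.flip d) := (M.faceOf_flip d).symm

end CombMap

/-! ### Cell structure of the torus -/

namespace KnotoidDiagram

variable {C : Type*} (K : KnotoidDiagram C)

/-- The cell decomposition of the sphere given by a knotoid diagram. -/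
def sphere : CombMap (KDart C) := ⟨KDart.rotate, K.glue, K.glue_glue, K.glue_ne⟩

theorem sphere_next_inr (b : Bool) : K.sphere.next (Sum.inr b) = Sum.inr b := rfl

theorem sphere_flip (d : KDart C) : K.sphere.flip d = K.glue d := rfl

theorem torus_next (v : C ⊕ Bool) (i : ZMod 4) : K.torus.next (v, i) = (v, i + 1) := rfl

theorem torus_flip_toTorus (d : KDart C) : K.torus.flip (toTorus d) = toTorus (K.glue d) :=
  K.torusFlip_toTorus d

theorem torus_flip_one (b : Bool) : K.torus.flip (Sum.inr b, 1) = (Sum.inr b, 3) :=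
  K.torusFlip_one b

theorem torus_flip_two (b : Bool) : K.torus.flip (Sum.inr b, 2) = (Sum.inr (!b), 2) :=
  K.torusFlip_two b

theorem torus_flip_three (b : Bool) : K.torus.flip (Sum.inr b, 3) = (Sum.inr b, 1) :=
  K.torusFlip_three b

/-- A function on the darts of the torus is constant if it is invariant under rotation and along
the arcs of the knotoid. -/
theorem torus_const {α : Type*} {f : TDart C → α} (hn : ∀ d, f (K.torus.next d) = f d)
    (hf : ∀ d, f (toTorus (K.glue d)) = f (toTorus d)) (d e : TDart C) : f d = f e := by
  have h1 : ∀ v i, f (v, i) = f (v, 0) := by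
    intro v i
    rw [← ZMod.natCast_zmod_val i]
    induction i.val with
    | zero => simp
    | succ n ih => rw [← ih, ← hn (v, (n : ZMod 4)), torus_next, Nat.cast_succ]
  have h2 : ∀ d e : KDart C, f (toTorus d) = f (toTorus e) := by
    refine K.spherical.1.const (f := fun d => f (toTorus d)) ?_ hf
    rintro (⟨c, i⟩ | b)
    · exact hn (Sum.inl c, i)
    · rfl
  have h3 : ∀ d : TDart C, ∃ e : KDart C, f d = f (toTorus e) := by
    rintro ⟨c | b, i⟩
    · exact ⟨Sum.inl (c, i), rfl⟩
    · exact ⟨Sum.inr b, h1 _ _⟩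
  obtain ⟨d', hd⟩ := h3 d
  obtain ⟨e', he⟩ := h3 e
  rw [hd, he, h2 d' e']

theorem torus_faceOf_zero (b : Bool) :
    K.torus.faceOf (Sum.inr b, 0) = K.torus.faceOf (Sum.inr b, 1) := by
  have h := K.torus.faceOf_next (Sum.inr b, 3)
  rw [torus_flip_three, torus_next] at h
  exact h

/-- The corners 2 and 3 at both endpoints are the four corners of the square on the handle;
`(Sum.inr false, 2)` serves as its representative. -/
theorem torus_faceOf_three (b : Bool) :
    K.torus.faceOf (Sum.inr b, 3) = K.torus.faceOf (Sum.inr false, 2) := by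
  have h1 : ∀ b, K.torus.faceOf (Sum.inr b, 3) = K.torus.faceOf (Sum.inr (!b), 2) := by
    intro b
    have h := K.torus.faceOf_next (Sum.inr b, 2)
    rw [torus_flip_two, torus_next] at h
    exact h
  have h2 : ∀ b, K.torus.faceOf (Sum.inr b, 3) = K.torus.faceOf (Sum.inr b, 2) := by
    intro b
    have h := K.torus.faceOf_flip (Sum.inr b, 1)
    rw [torus_flip_one, torus_next] at h
    exact h
  cases b
  · exact h2 false
  · exact h1 true

theorem torus_faceOf_two (b : Bool) :
    K.torus.faceOf (Sum.inr b, 2) = K.torus.faceOf (Sum.inr false, 2) := by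
  rw [← K.torus_faceOf_three b]
  have h := K.torus.faceOf_flip (Sum.inr b, 1)
  rw [torus_flip_one, torus_next] at h
  exact h.symm

/-- The face of the sphere from which a corner of the torus comes, if there is one. -/
def sphereFace : TDart C → Option K.sphere.Face
  | (Sum.inl c, i) => some (K.sphere.faceOf (Sum.inl (c, i)))
  | (Sum.inr b, i) => if i = 0 ∨ i = 1 then some (K.sphere.faceOf (Sum.inr b)) else none

theorem sphereFace_toTorus (d : KDart C) :
    K.sphereFace (toTorus d) = some (K.sphere.faceOf d) := by
  rcases d with ⟨c, i⟩ | b <;> simp [toTorus, sphereFace]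

/-- The faces of the torus are those of the sphere and the square on the handle. -/
def torusFaceEquiv : K.torus.Face ≃ Option K.sphere.Face where
  toFun := K.torus.faceLift K.sphereFace (by
    have h11 : (1 : ZMod 4) + 1 = 2 := by decide
    have h21 : (2 : ZMod 4) + 1 = 3 := by decide
    have h31 : (3 : ZMod 4) + 1 = 0 := by decide
    have h20 : (2 : ZMod 4) ≠ 0 ∧ (2 : ZMod 4) ≠ 1 := by decide
    have h30 : (3 : ZMod 4) ≠ 0 ∧ (3 : ZMod 4) ≠ 1 := by decide
    intro d
    rcases tdart_cases d with ⟨⟨c, i⟩ | b, rfl⟩ | ⟨b, rfl⟩ | ⟨b, rfl⟩ | ⟨b, rfl⟩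
    · rw [torus_flip_toTorus, sphereFace_toTorus]
      exact congrArg some (K.sphere.faceOf_next (Sum.inl (c, i)))
    · rw [torus_flip_toTorus, sphereFace_toTorus]
      have h : K.sphere.faceOf (Sum.inr b) = K.sphere.faceOf (K.glue (Sum.inr b)) :=
        K.sphere.faceOf_next (Sum.inr b)
      rw [← h]
      simp [toTorus, torus_next, sphereFace]
    · rw [torus_flip_one, torus_next, h11]; simp [sphereFace, h20, h30]
    · rw [torus_flip_two, torus_next, h21]; simp [sphereFace, h20, h30]
    · rw [torus_flip_three, torus_next, h31]; simp [sphereFace])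
  invFun o := o.elim (K.torus.faceOf (Sum.inr false, 2))
    (K.sphere.faceLift (fun d => K.torus.faceOf (toTorus d)) (by
      rintro (⟨c, i⟩ | b)
      · have h := K.torus.faceOf_next (Sum.inl c, i)
        rw [sphere_flip, ← torus_flip_toTorus]
        exact h
      · have h := K.torus.faceOf_next (Sum.inr b, 0)
        rw [sphere_flip, ← torus_flip_toTorus, sphere_next_inr]
        exact (K.torus_faceOf_zero b).trans h))
  left_inv := by
    have h20 : (2 : ZMod 4) ≠ 0 ∧ (2 : ZMod 4) ≠ 1 := by decide
    have h30 : (3 : ZMod 4) ≠ 0 ∧ (3 : ZMod 4) ≠ 1 := by decide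
    rintro ⟨d⟩
    change Option.elim (K.sphereFace d) _ _ = K.torus.faceOf d
    rcases tdart_cases d with ⟨e, rfl⟩ | ⟨b, rfl⟩ | ⟨b, rfl⟩ | ⟨b, rfl⟩
    · rw [sphereFace_toTorus]; rfl
    · simp only [sphereFace, or_true, if_true]
      exact K.torus_faceOf_zero b
    · simpa [sphereFace, h20] using (K.torus_faceOf_two b).symm
    · simpa [sphereFace, h30] using (K.torus_faceOf_three b).symm
  right_inv := by
    have h20 : (2 : ZMod 4) ≠ 0 ∧ (2 : ZMod 4) ≠ 1 := by decide
    rintro (_ | ⟨⟨d⟩⟩)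
    · change K.sphereFace (Sum.inr false, 2) = none
      simp [sphereFace, h20]
    · exact K.sphereFace_toTorus d

/-- The vertices of the sphere are the crossings and the endpoints. -/
def sphereVertexEquiv : K.sphere.Vertex ≃ C ⊕ Bool :=
  K.sphere.vertexEquiv (Sum.map Prod.fst id) (Sum.map (fun c => (c, 0)) id)
    (by rintro (⟨c, i⟩ | b) <;> rfl) (by rintro (c | b) <;> rfl) (by
      rintro (⟨c, i⟩ | b)
      · change K.sphere.vertexOf (Sum.inl (c, 0)) = K.sphere.vertexOf (Sum.inl (c, i))
        rw [← ZMod.natCast_zmod_val i]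
        induction i.val with
        | zero => simp
        | succ n ih =>
          rw [ih, ← K.sphere.vertexOf_next, Nat.cast_succ]
          rfl
      · rfl)

/-- The vertices of the torus are the crossings and the endpoints. -/
def torusVertexEquiv : K.torus.Vertex ≃ C ⊕ Bool :=
  K.torus.vertexEquiv Prod.fst (fun v => (v, 0)) (fun _ => rfl) (fun _ => rfl)
    (fun d => K.torus_vertexOf d.1 0 d.2)

section Card

variable [Fintype C]

theorem card_torus_vertex : Nat.card K.torus.Vertex = Nat.card C + 2 := by
  rw [Nat.card_congr K.torusVertexEquiv]; simp

theorem card_torus_edge : Nat.card K.torus.Edge = 2 * Nat.card C + 4 := by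
  have h := K.torus.two_mul_card_edge
  simp only [Nat.card_prod, Nat.card_sum, Nat.card_zmod] at h
  simp at h ⊢
  omega

/-- Euler's formula on the sphere gives one face more than there are crossings, and the handle adds
the square. -/
theorem card_torus_face : Nat.card K.torus.Face = Nat.card C + 2 := by
  have h1 : Nat.card K.torus.Face = Nat.card K.sphere.Face + 1 := by
    rw [Nat.card_congr K.torusFaceEquiv, Finite.card_option]
  have h2 : K.sphere.eulerChar = 2 := K.spherical.2
  have h3 := K.sphere.two_mul_card_edge
  rw [CombMap.eulerChar, Nat.card_congr K.sphereVertexEquiv] at h2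
  simp at h2 h3 ⊢
  omega

end Card

end KnotoidDiagram

/-! ### Local structure of a smoothed crossing -/

namespace BracketState

variable {C : Type*} (s : BracketState C)

/-- The first dart on each of the two arcs of the smoothing at `c`. -/
def base (c : C) (b : Bool) : ZMod 4 := if b then s.shift c + 2 else s.shift c

theorem eq_base (c : C) (i : ZMod 4) : ∃ b, i = s.base c b ∨ i = s.base c b + 1 := by
  have h : ∀ o i : ZMod 4, (i = o + 2 ∨ i = o + 2 + 1) ∨ (i = o ∨ i = o + 1) := by decide
  rcases h (s.shift c) i with h | h
  · exact ⟨true, by simpa [base] using h⟩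
  · exact ⟨false, by simpa [base] using h⟩

theorem base_add_one_add_one (c : C) (b : Bool) : s.base c b + 1 + 1 = s.base c (!b) := by
  have h : ∀ o : ZMod 4, o + 1 + 1 = o + 2 ∧ o + 2 + 1 + 1 = o := by decide
  cases b
  · exact (h _).1
  · exact (h _).2

theorem rotate_base (c : C) (b : Bool) :
    s.rotate (Sum.inl (Sum.inl c, s.base c b)) = Sum.inl (Sum.inl c, s.base c b + 1) := by
  change s.rotateFun (Sum.inl (Sum.inl c, s.base c b)) = _
  have h : ∀ o : ZMod 4, o ≠ o + 1 ∧ o ≠ o + 3 ∧ o + 2 ≠ o + 1 ∧ o + 2 ≠ o + 3 := by decide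
  obtain ⟨h1, h2, h3, h4⟩ := h (s.shift c)
  cases b <;> simp only [rotateFun, base, if_true, Bool.false_eq_true, if_false, h1, h2, h3, h4]

theorem rotate_base_add_one (c : C) (b : Bool) :
    s.rotate (Sum.inl (Sum.inl c, s.base c b + 1)) = Sum.inr (c, b) := by
  change s.rotateFun (Sum.inl (Sum.inl c, s.base c b + 1)) = _
  have h : ∀ o : ZMod 4, o + 2 + 1 = o + 3 ∧ o + 3 ≠ o + 1 := by decide
  obtain ⟨h1, h2⟩ := h (s.shift c)
  cases b <;> simp only [rotateFun, base, if_true, Bool.false_eq_true, if_false, h1, h2]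

theorem rotate_inr (c : C) (b : Bool) :
    s.rotate (Sum.inr (c, b)) = Sum.inl (Sum.inl c, s.base c b) := rfl

theorem rotate_endpoint (b : Bool) (i : ZMod 4) :
    s.rotate (Sum.inl (Sum.inr b, i)) = Sum.inl (Sum.inr b, i + 1) := rfl

theorem turn_base (c : C) (b : Bool) :
    s.turn (Sum.inl c, s.base c b) = (Sum.inl c, s.base c b + 1) := by
  change s.turnFun (Sum.inl c, s.base c b) = _
  cases b <;> simp [turnFun, base]

theorem turn_turn (d : TDart C) : s.turn (s.turn d) = d := s.turnFun_turnFun d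

theorem turn_base_add_one (c : C) (b : Bool) :
    s.turn (Sum.inl c, s.base c b + 1) = (Sum.inl c, s.base c b) := by
  rw [← turn_base, turn_turn]

theorem turn_endpoint (b : Bool) (i : ZMod 4) :
    s.turn (Sum.inr b, i) = (Sum.inr b, i + 2) := rfl

theorem turn_ne (d : TDart C) : s.turn d ≠ d := by
  have h1 : ∀ i : ZMod 4, i + 1 ≠ i := by decide
  have h2 : ∀ i : ZMod 4, i + 2 ≠ i := by decide
  obtain ⟨c | b, i⟩ := d
  · obtain ⟨b, rfl | rfl⟩ := s.eq_base c i
    · rw [turn_base]; exact fun h => h1 _ (congrArg Prod.snd h)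
    · rw [turn_base_add_one]; exact fun h => h1 _ (congrArg Prod.snd h).symm
  · exact fun h => h2 _ (congrArg Prod.snd h)

/-- The vertex of the smoothed diagram to which a dart is attached. -/
def label : Dart C → (C × Bool) ⊕ Bool
  | Sum.inl (Sum.inl c, i) =>
      Sum.inl (c, if i = s.base c true ∨ i = s.base c true + 1 then true else false)
  | Sum.inl (Sum.inr b, _) => Sum.inr b
  | Sum.inr (c, b) => Sum.inl (c, b)

theorem label_base (c : C) (b : Bool) :
    s.label (Sum.inl (Sum.inl c, s.base c b)) = Sum.inl (c, b) := by
  have h : ∀ o : ZMod 4, o ≠ o + 2 ∧ o ≠ o + 2 + 1 := by decide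
  obtain ⟨h1, h2⟩ := h (s.shift c)
  cases b <;> simp only [label, base, if_true, Bool.false_eq_true, if_false, h1, h2, true_or,
    or_self]

theorem label_base_add_one (c : C) (b : Bool) :
    s.label (Sum.inl (Sum.inl c, s.base c b + 1)) = Sum.inl (c, b) := by
  have h : ∀ o : ZMod 4, o + 1 ≠ o + 2 ∧ o + 1 ≠ o + 2 + 1 := by decide
  obtain ⟨h1, h2⟩ := h (s.shift c)
  cases b <;> simp only [label, base, if_true, Bool.false_eq_true, if_false, h1, h2, or_true,
    or_self]

end BracketState

/-! ### Cell structure of the smoothed diagram -/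

namespace KnotoidDiagram

open BracketState

variable {C : Type*} (K : KnotoidDiagram C) (s : BracketState C)

theorem stateMap_flip_inl (d : TDart C) :
    (K.stateMap s).flip (Sum.inl d) = Sum.inl (K.torus.flip d) := rfl

theorem stateMap_flip_inr (c : C) (b : Bool) :
    (K.stateMap s).flip (Sum.inr (c, b)) = Sum.inr (c, !b) := rfl

theorem stateMap_next : (K.stateMap s).next = s.rotate := rfl

/-- The vertices of the smoothed diagram. -/
def stateVertexEquiv : (K.stateMap s).Vertex ≃ (C × Bool) ⊕ Bool :=
  (K.stateMap s).vertexEquiv s.label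
    (Sum.elim Sum.inr (fun b => Sum.inl (Sum.inr b, 0)))
    (by
      rintro (⟨c | b, i⟩ | ⟨c, b⟩)
      · obtain ⟨b, rfl | rfl⟩ := s.eq_base c i
        · rw [stateMap_next, rotate_base, label_base, label_base_add_one]
        · rw [stateMap_next, rotate_base_add_one, label_base_add_one]; rfl
      · rfl
      · rw [stateMap_next, rotate_inr, label_base]; rfl)
    (by rintro (⟨c, b⟩ | b) <;> rfl)
    (by
      have h0 : ∀ c b, (K.stateMap s).vertexOf (Sum.inr (c, b)) =
          (K.stateMap s).vertexOf (Sum.inl (Sum.inl c, s.base c b)) := by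
        intro c b
        rw [← rotate_inr, ← K.stateMap_next s, CombMap.vertexOf_next]
      rintro (⟨c | b, i⟩ | ⟨c, b⟩)
      · obtain ⟨b, rfl | rfl⟩ := s.eq_base c i
        · rw [label_base]; exact h0 c b
        · rw [label_base_add_one, ← rotate_base, ← K.stateMap_next s, CombMap.vertexOf_next]
          exact h0 c b
      · change (K.stateMap s).vertexOf (Sum.inl (Sum.inr b, 0)) = _
        rw [← ZMod.natCast_zmod_val i]
        induction i.val with
        | zero => simp
        | succ n ih =>
          rw [ih, Nat.cast_succ, ← rotate_endpoint, ← K.stateMap_next s, CombMap.vertexOf_next]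
      · rfl)

theorem stateMap_vertexOf_eq_iff {d e : Dart C} :
    (K.stateMap s).vertexOf d = (K.stateMap s).vertexOf e ↔ s.label d = s.label e := by
  rw [← (K.stateVertexEquiv s).injective.eq_iff]; rfl

theorem stateMap_faceOf_inr (c : C) (b : Bool) :
    (K.stateMap s).faceOf (Sum.inr (c, b)) =
      (K.stateMap s).faceOf (Sum.inl (Sum.inl c, s.base c (!b))) := by
  rw [← rotate_inr, ← K.stateMap_next s, CombMap.faceOf_next, stateMap_flip_inr, Bool.not_not]

/-- Rotation in the torus, seen in the smoothed diagram. -/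
theorem stateMap_faceOf_torus_next (d : TDart C) :
    (K.stateMap s).faceOf (Sum.inl (K.torus.next d)) =
      (K.stateMap s).faceOf (Sum.inl (K.torus.flip d)) := by
  rw [← stateMap_flip_inl, ← CombMap.faceOf_next, stateMap_next]
  obtain ⟨c | b, i⟩ := d
  · obtain ⟨b, rfl | rfl⟩ := s.eq_base c i
    · rw [rotate_base]; rfl
    · rw [rotate_base_add_one, stateMap_faceOf_inr, ← base_add_one_add_one]; rfl
  · rfl

/-- Smoothing does not change the faces. -/
def stateFaceEquiv : (K.stateMap s).Face ≃ K.torus.Face where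
  toFun := (K.stateMap s).faceLift
    (Sum.elim K.torus.faceOf (fun x => K.torus.faceOf (Sum.inl x.1, s.base x.1 (!x.2)))) (by
      rw [stateMap_next]
      rintro (⟨c | b, i⟩ | ⟨c, b⟩)
      · obtain ⟨b, rfl | rfl⟩ := s.eq_base c i
        · rw [rotate_base]; exact K.torus.faceOf_next (Sum.inl c, s.base c b)
        · rw [rotate_base_add_one]
          simp only [Sum.elim_inr]
          rw [← base_add_one_add_one]
          exact K.torus.faceOf_next (Sum.inl c, s.base c b + 1)
      · exact K.torus.faceOf_next (Sum.inr b, i)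
      · rw [rotate_inr, stateMap_flip_inr]; simp)
  invFun := K.torus.faceLift (fun d => (K.stateMap s).faceOf (Sum.inl d))
    (K.stateMap_faceOf_torus_next s)
  left_inv := by
    rintro ⟨d | ⟨c, b⟩⟩
    · rfl
    · exact (K.stateMap_faceOf_inr s c b).symm
  right_inv := by rintro ⟨d⟩; rfl

/-- A function on the darts of the smoothed diagram is constant if it is invariant under rotation,
along the new edges and along the arcs of the knotoid. -/
theorem stateMap_const {α : Type*} {f : Dart C → α}
    (hn : ∀ d, f ((K.stateMap s).next d) = f d) (hf : ∀ d, f ((K.stateMap s).flip d) = f d)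
    (d e : Dart C) : f d = f e := by
  have h1 : ∀ d e, f (Sum.inl d) = f (Sum.inl e) := by
    refine K.torus_const (f := fun d => f (Sum.inl d)) ?_ fun d => ?_
    · rintro ⟨c | b, i⟩
      · obtain ⟨b, rfl | rfl⟩ := s.eq_base c i
        · rw [← hn (Sum.inl (Sum.inl c, s.base c b)), stateMap_next, rotate_base]; rfl
        · rw [← hn (Sum.inl (Sum.inl c, s.base c b + 1)), stateMap_next, rotate_base_add_one,
            ← hf (Sum.inr _), stateMap_flip_inr, ← hn (Sum.inr _), stateMap_next, rotate_inr,
            ← base_add_one_add_one]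
          rfl
      · exact hn (Sum.inl (Sum.inr b, i))
    · rw [← torus_flip_toTorus, ← stateMap_flip_inl, hf]
  have h2 : ∀ d, ∃ e, f d = f (Sum.inl e) := by
    rintro (d | ⟨c, b⟩)
    · exact ⟨d, rfl⟩
    · exact ⟨_, (hn (Sum.inr (c, b))).symm⟩
  obtain ⟨d', hd⟩ := h2 d
  obtain ⟨e', he⟩ := h2 e
  rw [hd, he, h1 d' e']

section Card

variable [Fintype C]

theorem card_state_vertex : Nat.card (K.stateMap s).Vertex = 2 * Nat.card C + 2 := by
  rw [Nat.card_congr (K.stateVertexEquiv s)]; simp [mul_comm]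

theorem card_state_edge : Nat.card (K.stateMap s).Edge = 3 * Nat.card C + 4 := by
  have h := (K.stateMap s).two_mul_card_edge
  simp at h ⊢
  omega

/-- With the counts of vertices and edges this makes the Euler characteristic zero, as needed in
`card_side`. -/
theorem card_state_face : Nat.card (K.stateMap s).Face = Nat.card C + 2 := by
  rw [Nat.card_congr (K.stateFaceEquiv s), card_torus_face]

end Card

end KnotoidDiagram

/-! ### Integral homology of the torus -/

theorem Nat.card_compl_singleton_add_one {α : Type*} [Finite α] (a : α) :
    Nat.card ({a}ᶜ : Set α) + 1 = Nat.card α := by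
  have h := Set.ncard_add_ncard_compl ({a} : Set α)
  rw [Set.ncard_singleton, add_comm] at h
  exact h

namespace CombMap

variable {D : Type*} {M : CombMap D} [Fintype D]

theorem cycles_flip (z : M.cycles) (d : D) : z.1 (M.flip d) = - z.1 d := z.2.1 d

theorem cast_mem_chains (z : M.cycles) : (fun d => (z.1 d : ℚ)) ∈ M.chains Set.univ :=
  ⟨fun d => by simp only [cycles_flip]; push_cast; rfl, fun d h => absurd (Set.mem_univ _) h⟩

theorem isClosed_cast (z : M.cycles) : M.IsClosed (fun d => (z.1 d : ℚ)) := by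
  intro d
  have h := z.2.2 d
  rw [← Int.cast_sum]
  exact_mod_cast h

theorem homClass_eq_iff {z w : M.cycles} : M.homClass z = M.homClass w ↔
    ∃ g : M.Face → ℤ, ∀ d, z.1 d - w.1 d = g (M.faceOf d) - g (M.faceOf (M.flip d)) := by
  rw [homClass, homClass, Submodule.Quotient.eq]
  constructor
  · rintro ⟨g, hg⟩
    exact ⟨g, fun d => (congrFun (congrArg Subtype.val hg) d).symm⟩
  · rintro ⟨g, hg⟩
    exact ⟨g, Subtype.ext (funext fun d => (hg d).symm)⟩

theorem homClass_add (z w : M.cycles) : M.homClass (z + w) = M.homClass z + M.homClass w := rfl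

theorem homClass_smul (k : ℤ) (z : M.cycles) : M.homClass (k • z) = k • M.homClass z := rfl

end CombMap

namespace KnotoidDiagram

open BracketState

variable {C : Type*} (K : KnotoidDiagram C)

/-- Both sides of the closing arc are the square. Hence every boundary has coefficient zero there,
and the coefficient of the closing arc is a homology invariant. -/
theorem torus_faceOf_closing (b : Bool) : K.torus.faceOf (Sum.inr b, 2) =
    K.torus.faceOf (K.torus.flip (Sum.inr b, 2)) := by
  rw [torus_flip_two, torus_faceOf_two, torus_faceOf_two K (!b)]

/-- A function on the faces that may only change across the attaching circle at the tail is
constant. -/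
theorem face_const {α : Type*} {g : K.torus.Face → α}
    (h : ∀ d, d ≠ (Sum.inr false, 1) → d ≠ (Sum.inr false, 3) →
      g (K.torus.faceOf d) = g (K.torus.faceOf (K.torus.flip d))) (x y : K.torus.Face) :
    g x = g y := by
  have h01 : ∀ b : Bool, ((Sum.inr b, 0) : TDart C) ≠ (Sum.inr false, 1) ∧
      ((Sum.inr b, 0) : TDart C) ≠ (Sum.inr false, 3) :=
    fun b => ⟨fun h => absurd (congrArg Prod.snd h) (show ¬ (0 : ZMod 4) = 1 by decide),
      fun h => absurd (congrArg Prod.snd h) (show ¬ (0 : ZMod 4) = 3 by decide)⟩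
  have h1 : ∀ d e : KDart C, g (K.torus.faceOf (toTorus d)) = g (K.torus.faceOf (toTorus e)) := by
    have hn : ∀ d : KDart C, toTorus d ≠ (Sum.inr false, 1) ∧ toTorus d ≠ (Sum.inr false, 3) := by
      rintro (⟨c, i⟩ | b)
      · simp [toTorus]
      · exact h01 b
    refine K.spherical.1.const (f := fun d => g (K.torus.faceOf (toTorus d))) ?_ fun d => ?_
    · rintro (⟨c, i⟩ | b)
      · have h2 := K.torus.faceOf_next (Sum.inl c, i)
        rw [torus_next] at h2
        have h3 := h (Sum.inl c, i) (hn (Sum.inl (c, i))).1 (hn (Sum.inl (c, i))).2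
        rw [← h2] at h3
        exact h3.symm
      · rfl
    · change g (K.torus.faceOf (toTorus (K.glue d))) = _
      rw [← torus_flip_toTorus]
      exact (h _ (hn d).1 (hn d).2).symm
  have h2 : ∀ e, g (K.torus.faceOf (Sum.inr false, 2)) = g (K.torus.faceOf (toTorus e)) := by
    intro e
    rw [h1 e (Sum.inr true)]
    -- The circle at the head may be crossed, and it joins the square to a face of the sphere.
    have h3 := h (Sum.inr true, 3) (by simp) (by simp)
    rw [torus_faceOf_three, torus_flip_three, ← torus_faceOf_zero] at h3
    exact h3
  have h3 : ∀ x, g x = g (K.torus.faceOf (Sum.inr false, 2)) := by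
    rintro ⟨d⟩
    change g (K.torus.faceOf d) = _
    rcases tdart_cases d with ⟨e, rfl⟩ | ⟨b, rfl⟩ | ⟨b, rfl⟩ | ⟨b, rfl⟩
    · exact (h2 e).symm
    · rw [← torus_faceOf_zero]; exact (h2 (Sum.inr b)).symm
    · rw [torus_faceOf_two]
    · rw [torus_faceOf_three]
  rw [h3 x, h3 y]

/-- The attaching circle is a single loop: having run along it and gone straight on, one is back at
the same dart. -/
theorem sameCycle_meridian_iff (e : TDart C) : Equiv.Perm.SameCycle
    ((show Equiv.Perm (TDart C) from Equiv.prodCongr (Equiv.refl (C ⊕ Bool))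
      (Equiv.addRight (2 : ZMod 4))) * K.torus.flip) (Sum.inr false, 1) e ↔
      (Sum.inr false, 1) = e := by
  refine ⟨fun h => ?_, fun h => h ▸ Equiv.Perm.SameCycle.refl _ _⟩
  obtain ⟨n, rfl⟩ := h
  symm
  apply Function.IsFixedPt.perm_zpow
  change Prod.map _ _ (K.torus.flip (Sum.inr false, 1)) = _
  rw [torus_flip_one]
  exact congrArg (Prod.mk _) (show (3 : ZMod 4) + 2 = 1 by decide)

theorem not_sameCycle_flip (s : BracketState C) (d : TDart C) :
    ¬ (s.turn * K.torus.flip).SameCycle d (K.torus.flip d) :=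
  Equiv.Perm.not_sameCycle_of_involutions s.turn_turn s.turn_ne K.torus.flip_flip
    K.torus.flip_ne d

section Homology

variable [Fintype C]

/-- The cycle of the attaching circle at the tail. -/
noncomputable def meridianCycle : K.torus.cycles :=
  K.torus.curve (Equiv.prodCongr (Equiv.refl _) (Equiv.addRight 2))
    (fun _ => K.torus_vertexOf _ _ _) (Sum.inr false, 1)

theorem homClass_meridianCycle : K.torus.homClass K.meridianCycle = K.meridian := rfl

theorem meridianCycle_one : K.meridianCycle.1 (Sum.inr false, 1) = 1 := by
  have h : (Sum.inr false, 1) ≠ K.torus.flip (Sum.inr false, 1) := (K.torus.flip_ne _).symm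
  exact (congrArg₂ (· - ·) (if_pos ((K.sameCycle_meridian_iff _).2 rfl))
    (if_neg fun h' => h ((K.sameCycle_meridian_iff _).1 h'))).trans (sub_zero 1)

theorem meridianCycle_of_ne {d : TDart C} (h1 : d ≠ (Sum.inr false, 1))
    (h3 : d ≠ (Sum.inr false, 3)) : K.meridianCycle.1 d = 0 := by
  have h4 : (Sum.inr false, 1) ≠ K.torus.flip d := fun h => h3 (by
    rw [← K.torus.flip_flip d, ← h, torus_flip_one])
  exact (congrArg₂ (· - ·) (if_neg fun h' => h1 ((K.sameCycle_meridian_iff _).1 h').symm)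
    (if_neg fun h' => h4 ((K.sameCycle_meridian_iff _).1 h'))).trans (sub_zero 0)

/-- The cycle of a state curve. -/
noncomputable def stateCycle (s : BracketState C) (d : TDart C) : K.torus.cycles :=
  K.torus.curve s.turn (K.vertexOf_turn s) d

theorem stateCycle_of_sameCycle {s : BracketState C} {d e : TDart C}
    (h : (s.turn * K.torus.flip).SameCycle d e) : (K.stateCycle s d).1 e = 1 := by
  have h2 : ¬ (s.turn * K.torus.flip).SameCycle d (K.torus.flip e) :=
    fun h' => K.not_sameCycle_flip s e (h.symm.trans h')
  simp [stateCycle, CombMap.curve, h, h2]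

theorem isLongitude_stateCycle (s : BracketState C) :
    K.IsLongitude (K.torus.homClass (K.stateCycle s (Sum.inr true, 2))) :=
  ⟨_, rfl, K.stateCycle_of_sameCycle (Equiv.Perm.SameCycle.refl _ _)⟩

/-- The meridian, one long curve and the boundaries span the cycles over ℚ. Evaluation on the
closing arc removes the long curve, and what remains can be made integral. -/
theorem exists_eq_meridian_add_boundary (z : K.torus.cycles) (hz : z.1 (Sum.inr true, 2) = 0) :
    ∃ (k : ℤ) (g : K.torus.Face → ℤ), ∀ d, z.1 d = k * K.meridianCycle.1 d +
      (g (K.torus.faceOf d) - g (K.torus.faceOf (K.torus.flip d))) := by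
  classical
  set mer : TDart C → ℚ := fun d => (K.meridianCycle.1 d : ℚ) with hmer
  set lon : TDart C → ℚ := fun d =>
    ((K.stateCycle (fun _ => true) (Sum.inr true, 2)).1 d : ℚ) with hlon
  have hmer2 : mer (Sum.inr true, 2) = 0 := by
    rw [hmer]
    simp only
    rw [K.meridianCycle_of_ne (by simp) (by simp)]
    rfl
  have hlon2 : lon (Sum.inr true, 2) = 1 := by
    rw [hlon]
    simp only
    rw [K.stateCycle_of_sameCycle (Equiv.Perm.SameCycle.refl _ _)]
    rfl
  have hclos : ∀ g, K.torus.bdry g (Sum.inr true, 2) = 0 := fun g => by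
    rw [CombMap.bdry_apply, ← torus_faceOf_closing, sub_self]
  -- One vertex and one face are left out to kill the constants. For `n` crossings the count is `(n
  -- + 1) + 2 + (n + 1) = 2n + 4`, the number of edges, so the equality case applies.
  obtain ⟨-, hex⟩ := CombMap.card_add_card_le (M := K.torus) (n := 2) (E := Set.univ)
    (A := {K.torus.vertexOf (Sum.inr true, 2)}ᶜ) (B := {K.torus.faceOf (Sum.inr true, 2)}ᶜ)
    (c := ![mer, lon]) (fun _ _ => Set.mem_univ _)
    (fun i => by fin_cases i <;> exact CombMap.cast_mem_chains _)
    (fun i => by fin_cases i <;> exact CombMap.isClosed_cast _)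
    (fun f h0 hf => by
      have hc := K.torus_const (f := fun d => f (K.torus.vertexOf d))
        (fun d => by rw [CombMap.vertexOf_next]) (fun d => by
          have := congrFun hf (toTorus d)
          rw [CombMap.cobdry_apply, torus_flip_toTorus] at this
          exact (sub_eq_zero.1 this).symm)
      ext ⟨d⟩
      exact (hc d (Sum.inr true, 2)).trans (h0 _ (by simp)))
    (fun g a h0 hg => by
      have hg' : ∀ d, K.torus.bdry g d + (a 0 * mer d + a 1 * lon d) = 0 := fun d => by
        simpa [Fin.sum_univ_two] using hg d (Set.mem_univ _)
      have ha1 : a 1 = 0 := by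
        have := hg' (Sum.inr true, 2)
        rw [hclos, hmer2, hlon2] at this
        linarith
      have hconst := K.face_const (g := g) (fun d h1 h3 => by
        have := hg' d
        rw [ha1, hmer] at this
        simp only [K.meridianCycle_of_ne h1 h3, CombMap.bdry_apply] at this
        push_cast at this
        linarith)
      have hg0 : g = 0 := by
        ext x
        exact (hconst x _).trans (h0 (K.torus.faceOf (Sum.inr true, 2)) (by simp))
      have ha0 : a 0 = 0 := by
        have := hg' (Sum.inr false, 1)
        rw [ha1, hmer, hg0] at this
        simpa [K.meridianCycle_one] using this
      refine ⟨hg0, ?_⟩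
      ext i
      fin_cases i
      · exact ha0
      · exact ha1)
  have hA := Nat.card_compl_singleton_add_one (K.torus.vertexOf (Sum.inr true, 2))
  have hB := Nat.card_compl_singleton_add_one (K.torus.faceOf (Sum.inr true, 2))
  rw [card_torus_vertex] at hA
  rw [card_torus_face] at hB
  obtain ⟨g, a, hga⟩ := hex (by
    rw [Nat.card_univ, card_torus_edge]; omega) _ (CombMap.cast_mem_chains z)
    (CombMap.isClosed_cast z)
  have hga' : ∀ d, (z.1 d : ℚ) = K.torus.bdry g d + (a 0 * mer d + a 1 * lon d) := fun d => by
    simpa [Fin.sum_univ_two] using hga d (Set.mem_univ _)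
  have ha1 : a 1 = 0 := by
    have := hga' (Sum.inr true, 2)
    rw [hclos, hmer2, hlon2, hz] at this
    push_cast at this
    linarith
  -- Across every edge except the circle at the tail the jump of `g` is the integer `z.1 d`. So all
  -- values of `g` have the same fractional part, and `g` may be replaced by its floor.
  have hfract := K.face_const (g := fun x => Int.fract (g x)) (fun d h1 h3 => by
    have := hga' d
    rw [ha1, hmer] at this
    simp only [K.meridianCycle_of_ne h1 h3, CombMap.bdry_apply] at this
    push_cast at this
    have h : g (K.torus.faceOf d) = g (K.torus.faceOf (K.torus.flip d)) + (z.1 d : ℤ) := by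
      linarith
    simp only [h, Int.fract_add_intCast])
  have hfloor : ∀ d, K.torus.bdry g d =
      (⌊g (K.torus.faceOf d)⌋ : ℚ) - ⌊g (K.torus.faceOf (K.torus.flip d))⌋ := fun d => by
    have h := hfract (K.torus.faceOf d) (K.torus.faceOf (K.torus.flip d))
    simp only [Int.fract] at h
    rw [CombMap.bdry_apply]
    linarith
  -- The meridian has coefficient 1 on the circle at the tail, so evaluation there shows that its
  -- multiplicity is an integer.
  have ha0 : a 0 = ((z.1 (Sum.inr false, 1) - (⌊g (K.torus.faceOf (Sum.inr false, 1))⌋ -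
      ⌊g (K.torus.faceOf (K.torus.flip (Sum.inr false, 1)))⌋) : ℤ) : ℚ) := by
    have := hga' (Sum.inr false, 1)
    rw [hfloor, ha1, hmer] at this
    simp only [K.meridianCycle_one] at this
    push_cast at this ⊢
    linarith
  refine ⟨z.1 (Sum.inr false, 1) - (⌊g (K.torus.faceOf (Sum.inr false, 1))⌋ -
    ⌊g (K.torus.faceOf (K.torus.flip (Sum.inr false, 1)))⌋), fun x => ⌊g x⌋, fun d => ?_⟩
  have := hga' d
  rw [hfloor, ha1, ha0] at this
  rw [← Int.cast_inj (α := ℚ), this, hmer]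
  push_cast
  ring

theorem exists_eq_add_smul_meridian {z w : K.torus.cycles}
    (h : z.1 (Sum.inr true, 2) = w.1 (Sum.inr true, 2)) :
    ∃ k : ℤ, K.torus.homClass z = K.torus.homClass w + k • K.meridian := by
  obtain ⟨k, g, hg⟩ := K.exists_eq_meridian_add_boundary (z - w) (by
    change z.1 _ - w.1 _ = 0
    rw [h, sub_self])
  refine ⟨k, ?_⟩
  rw [← homClass_meridianCycle, ← CombMap.homClass_smul, ← CombMap.homClass_add,
    CombMap.homClass_eq_iff]
  refine ⟨g, fun d => ?_⟩
  have := hg d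
  change z.1 d - w.1 d = _ at this
  change z.1 d - (w.1 d + k * K.meridianCycle.1 d) = _
  linarith

/-- In a relation the closing arc kills the coefficient of the longitude; then the bounding 2-chain
is constant by `face_const`, which kills that of the meridian. For spanning, the coefficient of the
longitude is read off on the closing arc. -/
theorem longitude_meridian_basis {lam : K.torus.H1} (hlam : K.IsLongitude lam) :
    LinearIndependent ℤ ![lam, K.meridian] ∧ Submodule.span ℤ {lam, K.meridian} = ⊤ := by
  obtain ⟨l, rfl, hl⟩ := hlam
  constructor
  · rw [LinearIndependent.pair_iff]
    intro a b hab
    rw [← homClass_meridianCycle, ← CombMap.homClass_smul, ← CombMap.homClass_smul,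
      ← CombMap.homClass_add, show (0 : K.torus.H1) = K.torus.homClass 0 from rfl,
      CombMap.homClass_eq_iff] at hab
    obtain ⟨g, hg⟩ := hab
    have hg' : ∀ d, a * l.1 d + b * K.meridianCycle.1 d =
        g (K.torus.faceOf d) - g (K.torus.faceOf (K.torus.flip d)) := fun d => by
      rw [← hg]
      change _ = a * l.1 d + b * K.meridianCycle.1 d - 0
      ring
    have ha : a = 0 := by
      have := hg' (Sum.inr true, 2)
      rwa [← torus_faceOf_closing, hl, K.meridianCycle_of_ne (by simp) (by simp), sub_self,
        mul_one, mul_zero, add_zero] at this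
    have hc := K.face_const (g := g) (fun d h1 h3 => by
      have := hg' d
      rw [ha, K.meridianCycle_of_ne h1 h3] at this
      linarith)
    have := hg' (Sum.inr false, 1)
    rw [ha, K.meridianCycle_one, hc _ (K.torus.faceOf (Sum.inr false, 1)),
      hc (K.torus.faceOf (K.torus.flip (Sum.inr false, 1)))
        (K.torus.faceOf (Sum.inr false, 1))] at this
    exact ⟨ha, by linarith⟩
  · rw [eq_top_iff]
    rintro x -
    obtain ⟨z, rfl⟩ := Submodule.Quotient.mk_surjective _ x
    obtain ⟨k, hk⟩ := K.exists_eq_add_smul_meridian (z := z) (w := z.1 (Sum.inr true, 2) • l) (by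
      change _ = z.1 _ * l.1 _
      rw [hl, mul_one])
    change K.torus.homClass z ∈ _
    rw [hk, Submodule.mem_span_pair]
    exact ⟨z.1 (Sum.inr true, 2), k, rfl⟩

end Homology

end KnotoidDiagram

/-! ### Components of a state, the long component and separation -/

namespace KnotoidDiagram

open BracketState

variable {C : Type*} (K : KnotoidDiagram C) (s : BracketState C)

/-- The component of the state that runs through a dart. -/
def component (d : TDart C) : Set (TDart C) :=
  MulAction.orbit (Subgroup.closure ({K.torus.flip, s.turn} : Set (Equiv.Perm (TDart C)))) d

theorem mem_component_self (d : TDart C) : d ∈ K.component s d := MulAction.mem_orbit_self d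

theorem component_eq_of_mem {d e : TDart C} (h : e ∈ K.component s d) :
    K.component s e = K.component s d := MulAction.orbit_eq_iff.2 h

theorem flip_mem_component {d e : TDart C} (h : e ∈ K.component s d) :
    K.torus.flip e ∈ K.component s d := by
  rw [← K.component_eq_of_mem s h]
  exact ⟨⟨K.torus.flip, Subgroup.subset_closure (by simp)⟩, rfl⟩

theorem turn_mem_component {d e : TDart C} (h : e ∈ K.component s d) :
    s.turn e ∈ K.component s d := by
  rw [← K.component_eq_of_mem s h]
  exact ⟨⟨s.turn, Subgroup.subset_closure (by simp)⟩, rfl⟩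

theorem component_induction {Q : TDart C → Prop} {d : TDart C} (h0 : Q d)
    (hf : ∀ e ∈ K.component s d, Q e → Q (K.torus.flip e))
    (ht : ∀ e ∈ K.component s d, Q e → Q (s.turn e)) {e : TDart C}
    (he : e ∈ K.component s d) : Q e := by
  have key : ∀ g ∈ Subgroup.closure ({K.torus.flip, s.turn} : Set (Equiv.Perm (TDart C))),
      ∀ x, (x ∈ K.component s d ∧ Q x) → (g x ∈ K.component s d ∧ Q (g x)) := by
    intro g hg
    -- Both generators are involutions, so as a monoid they already generate the group and no
    -- inverses need to be treated.
    rw [← Subgroup.mem_toSubmonoid, Subgroup.closure_toSubmonoid] at hg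
    induction hg using Submonoid.closure_induction with
    | mem g hg =>
      have hfi : K.torus.flip⁻¹ = K.torus.flip :=
        inv_eq_of_mul_eq_one_right (Equiv.ext K.torus.flip_flip)
      have hti : s.turn⁻¹ = s.turn := inv_eq_of_mul_eq_one_right (Equiv.ext s.turn_turn)
      have hg' : g = K.torus.flip ∨ g = s.turn := by
        rcases hg with (rfl | rfl) | h
        · exact Or.inl rfl
        · exact Or.inr rfl
        · rcases Set.mem_inv.1 h with h | h
          · exact Or.inl (by rw [← inv_inv g, h, hfi])
          · exact Or.inr (by rw [← inv_inv g, Set.mem_singleton_iff.1 h, hti])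
      rintro x ⟨hx, hQ⟩
      rcases hg' with rfl | rfl
      · exact ⟨K.flip_mem_component s hx, hf x hx hQ⟩
      · exact ⟨K.turn_mem_component s hx, ht x hx hQ⟩
    | one => exact fun x hx => hx
    | mul g g' _ _ h h' => exact fun x hx => h _ (h' x hx)
  obtain ⟨⟨g, hg⟩, rfl⟩ := he
  exact (key g hg d ⟨K.mem_component_self s d, h0⟩).2

theorem sameCycle_turn_iff {d e : TDart C} :
    (s.turn * K.torus.flip).SameCycle d (s.turn e) ↔
      (s.turn * K.torus.flip).SameCycle d (K.torus.flip e) := by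
  rw [← Equiv.Perm.sameCycle_apply_right (y := K.torus.flip e), Equiv.Perm.mul_apply,
    K.torus.flip_flip]

theorem sameCycle_flip_turn_iff {d e : TDart C} :
    (s.turn * K.torus.flip).SameCycle d (K.torus.flip (s.turn e)) ↔
      (s.turn * K.torus.flip).SameCycle d e := by
  rw [← sameCycle_turn_iff, turn_turn]

/-- An orbit of the dihedral group splits into the two orientations of the curve; by
`not_sameCycle_flip` they are disjoint. -/
theorem mem_component_iff {d e : TDart C} : e ∈ K.component s d ↔
    (s.turn * K.torus.flip).SameCycle d e ∨
      (s.turn * K.torus.flip).SameCycle d (K.torus.flip e) := by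
  constructor
  · refine K.component_induction s (Q := fun e => (s.turn * K.torus.flip).SameCycle d e ∨
      (s.turn * K.torus.flip).SameCycle d (K.torus.flip e))
      (Or.inl (Equiv.Perm.SameCycle.refl _ _)) (fun e _ h => ?_) (fun e _ h => ?_)
    · rw [K.torus.flip_flip]; exact h.symm
    · rw [sameCycle_turn_iff, sameCycle_flip_turn_iff]; exact h.symm
  · have h1 : ∀ e, (s.turn * K.torus.flip).SameCycle d e → e ∈ K.component s d := by
      rintro _ ⟨n, rfl⟩
      exact ⟨⟨(s.turn * K.torus.flip) ^ n, Subgroup.zpow_mem _ (Subgroup.mul_mem _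
        (Subgroup.subset_closure (by simp)) (Subgroup.subset_closure (by simp))) _⟩, rfl⟩
    rintro (h | h)
    · exact h1 e h
    · rw [← K.torus.flip_flip e]; exact K.flip_mem_component s (h1 _ h)

theorem isKnotDart_flip {d : TDart C} (h : IsKnotDart d) : IsKnotDart (K.torus.flip d) := by
  rcases tdart_cases d with ⟨e, rfl⟩ | ⟨b, rfl⟩ | ⟨b, rfl⟩ | ⟨b, rfl⟩
  · rw [torus_flip_toTorus]
    rcases K.glue e with ⟨c, i⟩ | b
    · trivial
    · exact Or.inl rfl
  · exact absurd h (show ¬ ((1 : ZMod 4) = 0 ∨ (1 : ZMod 4) = 2) by decide)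
  · rw [torus_flip_two]; exact Or.inr rfl
  · exact absurd h (show ¬ ((3 : ZMod 4) = 0 ∨ (3 : ZMod 4) = 2) by decide)

theorem isKnotDart_turn {d : TDart C} (h : IsKnotDart d) : IsKnotDart (s.turn d) := by
  obtain ⟨c | b, i⟩ := d
  · trivial
  · have : ∀ i : ZMod 4, (i = 0 ∨ i = 2) → (i + 2 = 0 ∨ i + 2 = 2) := by decide
    exact this i h

theorem isKnotDart_of_mem_component {d e : TDart C} (hd : IsKnotDart d)
    (he : e ∈ K.component s d) : IsKnotDart e :=
  K.component_induction s hd (fun _ _ h => K.isKnotDart_flip h) (fun _ _ h => isKnotDart_turn s h) he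

theorem not_isKnotDart_one (b : Bool) : ¬ IsKnotDart ((Sum.inr b, 1) : TDart C) :=
  show ¬ ((1 : ZMod 4) = 0 ∨ (1 : ZMod 4) = 2) by decide

theorem not_isKnotDart_three (b : Bool) : ¬ IsKnotDart ((Sum.inr b, 3) : TDart C) :=
  show ¬ ((3 : ZMod 4) = 0 ∨ (3 : ZMod 4) = 2) by decide

/-- The component of the state that contains the closing arc. -/
def longComponent : Set (TDart C) := K.component s (Sum.inr true, 2)

theorem isKnotDart_of_mem_longComponent {e : TDart C} (he : e ∈ K.longComponent s) :
    IsKnotDart e := K.isKnotDart_of_mem_component s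
    (show IsKnotDart (Sum.inr true, 2) from Or.inr rfl) he

theorem endpoint_mem_longComponent (b : Bool) :
    ((Sum.inr b, 2) : TDart C) ∈ K.longComponent s ∧
      ((Sum.inr b, 0) : TDart C) ∈ K.longComponent s := by
  have h2 : ((Sum.inr b, 2) : TDart C) ∈ K.longComponent s := by
    cases b
    · have := K.flip_mem_component s (K.mem_component_self s (Sum.inr true, 2))
      rwa [torus_flip_two] at this
    · exact K.mem_component_self s _
  refine ⟨h2, ?_⟩
  have := K.turn_mem_component s h2
  rw [turn_endpoint] at this
  exact this

/-- All knot darts at both endpoints belong to the long component, and the ends of the attaching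
circles belong to no component of the state. -/
theorem endpoint_notMem_component {d : TDart C} (hd : IsKnotDart d)
    (hne : K.component s d ≠ K.longComponent s) (b : Bool) (i : ZMod 4) :
    ((Sum.inr b, i) : TDart C) ∉ K.component s d := by
  intro h
  have h1 : i = 0 ∨ i = 2 := K.isKnotDart_of_mem_component s hd h
  have h2 : ((Sum.inr b, i) : TDart C) ∈ K.longComponent s := by
    rcases h1 with rfl | rfl
    · exact (K.endpoint_mem_longComponent s b).2
    · exact (K.endpoint_mem_longComponent s b).1
  exact hne ((K.component_eq_of_mem s h).symm.trans (K.component_eq_of_mem s h2))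

theorem notMem_component_of_mem_longComponent {d e : TDart C}
    (hne : K.component s d ≠ K.longComponent s) (he : e ∈ K.longComponent s) :
    e ∉ K.component s d := fun h =>
  hne ((K.component_eq_of_mem s h).symm.trans (K.component_eq_of_mem s he))

/-- The square on the handle lies on both sides of the closing arc. -/
theorem longComponent_not_boundsDisk : ¬ K.ComponentBoundsDisk s (K.longComponent s) := by
  rintro ⟨X, hX, -⟩
  refine (hX (Sum.inl (Sum.inr true, 2))).1 ⟨_, K.mem_component_self s _, rfl⟩ ?_
  have h : (K.stateMap s).faceOf (Sum.inl (Sum.inr true, 2)) =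
      (K.stateMap s).faceOf ((K.stateMap s).flip (Sum.inl (Sum.inr true, 2))) :=
    (K.stateFaceEquiv s).injective (K.torus_faceOf_closing true)
  rw [← h]

theorem torus_faceOf_base_add_one (c : C) (b : Bool) :
    K.torus.faceOf (Sum.inl c, s.base c b + 1) =
      K.torus.faceOf (K.torus.flip (Sum.inl c, s.base c b)) :=
  K.torus.faceOf_next (Sum.inl c, s.base c b)

/-- A 2-chain whose boundary vanishes along the component of the closing arc and at the attaching
circle at the head has no boundary at the attaching circle at the tail. -/
theorem eq_at_tail_of_eq_along_longComponent [Finite C] {g : K.torus.Face → ℚ}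
    (h : ∀ d ∈ K.longComponent s, g (K.torus.faceOf d) = g (K.torus.faceOf (K.torus.flip d)))
    (h' : g (K.torus.faceOf (Sum.inr true, 1)) = g (K.torus.faceOf (Sum.inr true, 3))) :
    g (K.torus.faceOf (Sum.inr false, 1)) = g (K.torus.faceOf (Sum.inr false, 3)) := by
  classical
  have : Fintype C := Fintype.ofFinite C
  set p := s.turn * K.torus.flip with hp
  set a : TDart C := (Sum.inr true, 2) with ha
  have hfa : K.torus.flip a = (Sum.inr false, 2) := K.torus_flip_two true
  have hno : ¬ p.SameCycle a (Sum.inr false, 2) := hfa ▸ K.not_sameCycle_flip s a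
  -- The value of `g` to the left of someone walking along the long component, starting at the head
  -- along the closing arc.
  let L : TDart C → ℚ := fun d => g (K.torus.faceOf (K.torus.flip d))
  have hL : ∀ d, p.SameCycle a d → d ≠ a → L (p d) - L d = 0 := by
    intro d hd hda
    have hmem : d ∈ K.longComponent s := (K.mem_component_iff s).2 (Or.inl hd)
    have hfm := K.flip_mem_component s hmem
    have htm := K.turn_mem_component s hfm
    have hpd : p.SameCycle a (s.turn (K.torus.flip d)) := Equiv.Perm.sameCycle_apply_right.2 hd
    rw [sub_eq_zero]
    change g (K.torus.faceOf (K.torus.flip (s.turn (K.torus.flip d)))) =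
      -- The left side may be exchanged for the right one, since `g` does not jump across the long
      -- component. At a smoothed crossing the two darts of an arc share the corner between them,
      -- and at the head `h'` is used. The remaining cases are the excluded start or the opposite
      -- orientation.
      g (K.torus.faceOf (K.torus.flip d))
    rw [← h _ htm]
    have hknot := K.isKnotDart_of_mem_longComponent s hfm
    have hd' : K.torus.flip (K.torus.flip d) = d := K.torus.flip_flip d
    generalize K.torus.flip d = e at *
    obtain ⟨c | b, i⟩ := e
    · obtain ⟨b, rfl | rfl⟩ := s.eq_base c i
      · rw [turn_base, torus_faceOf_base_add_one, ← h _ hfm]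
      · rw [turn_base_add_one] at htm ⊢
        rw [torus_faceOf_base_add_one, ← h _ htm]
    · rcases hknot with rfl | rfl
      · cases b
        · exact absurd hpd hno
        · change g (K.torus.faceOf (Sum.inr true, 2)) = _
          rw [torus_faceOf_zero, h', torus_faceOf_three, torus_faceOf_two]
      · rw [torus_flip_two] at hd'
        cases b
        · exact absurd hd'.symm hda
        · exact absurd (hd' ▸ hd) hno
  -- The changes of `L` once around the closed curve sum to zero. All but the one at the tail, just
  -- after the closing arc, are zero, so that one vanishes too.
  have hsum : ∑ d with p.SameCycle a d, (L (p d) - L d) = 0 := by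
    rw [Finset.sum_sub_distrib, sub_eq_zero]
    exact Finset.sum_equiv p (fun d => by simp) (fun d _ => rfl)
  rw [Finset.sum_eq_single a
    (fun d hd hda => hL d (Finset.mem_filter.1 hd).2 hda) (fun h => absurd
      (Finset.mem_filter.2 ⟨Finset.mem_univ _, Equiv.Perm.SameCycle.refl _ _⟩) h),
    sub_eq_zero] at hsum
  have hpa : p a = (Sum.inr false, 0) := by
    rw [hp, Equiv.Perm.mul_apply, hfa]; rfl
  simp only [L, hpa, hfa] at hsum
  rw [← h _ (K.endpoint_mem_longComponent s false).2, torus_faceOf_zero] at hsum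
  rw [hsum, torus_faceOf_three]

/-- A function on the faces of the smoothed diagram that does not change across any edge is
constant. -/
theorem stateMap_face_const {α : Type*} {h : (K.stateMap s).Face → α}
    (hh : ∀ d, h ((K.stateMap s).faceOf d) = h ((K.stateMap s).faceOf ((K.stateMap s).flip d)))
    (x y : (K.stateMap s).Face) : h x = h y := by
  obtain ⟨d, rfl⟩ := Quotient.exists_rep x
  obtain ⟨e, rfl⟩ := Quotient.exists_rep y
  refine K.stateMap_const s (f := fun d => h ((K.stateMap s).faceOf d)) (fun d => ?_)
    (fun d => (hh d).symm) d e
  rw [CombMap.faceOf_next]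
  exact (hh d).symm

/-- Three corners meet at each vertex of a smoothed crossing. -/
theorem stateMap_faceOf_crossing (c : C) (b : Bool) :
    (K.stateMap s).faceOf (Sum.inl (Sum.inl c, s.base c b + 1)) =
      (K.stateMap s).faceOf ((K.stateMap s).flip (Sum.inl (Sum.inl c, s.base c b))) ∧
    (K.stateMap s).faceOf (Sum.inr (c, b)) =
      (K.stateMap s).faceOf ((K.stateMap s).flip (Sum.inl (Sum.inl c, s.base c b + 1))) ∧
    (K.stateMap s).faceOf (Sum.inl (Sum.inl c, s.base c b)) =
      (K.stateMap s).faceOf ((K.stateMap s).flip (Sum.inr (c, b))) := by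
  refine ⟨?_, ?_, ?_⟩ <;> rw [← CombMap.faceOf_next, stateMap_next]
  · rw [rotate_base]
  · rw [rotate_base_add_one]
  · rw [rotate_inr]

section Homology

variable [Fintype C]

theorem stateCycle_flip {d e : TDart C}
    (h : (s.turn * K.torus.flip).SameCycle d (K.torus.flip e)) : (K.stateCycle s d).1 e = -1 := by
  rw [← K.torus.flip_flip e, CombMap.cycles_flip, K.stateCycle_of_sameCycle h]

theorem stateCycle_of_notMem {d e : TDart C} (h : e ∉ K.component s d) :
    (K.stateCycle s d).1 e = 0 := by
  rw [mem_component_iff, not_or] at h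
  simp [stateCycle, CombMap.curve, h]

theorem stateCycle_turn (d e : TDart C) :
    (K.stateCycle s d).1 (s.turn e) = - (K.stateCycle s d).1 e := by
  by_cases he : e ∈ K.component s d
  · rcases (K.mem_component_iff s).1 he with h | h
    · rw [K.stateCycle_of_sameCycle h, K.stateCycle_flip s ((K.sameCycle_flip_turn_iff s).2 h)]
    · rw [K.stateCycle_flip s h, K.stateCycle_of_sameCycle ((K.sameCycle_turn_iff s).2 h), neg_neg]
  · have he' : s.turn e ∉ K.component s d := fun h =>
      he (s.turn_turn e ▸ K.turn_mem_component s h)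
    rw [K.stateCycle_of_notMem s he, K.stateCycle_of_notMem s he', neg_zero]

/-- The coefficients are 1 and -1 on the component and 0 elsewhere; parity forgets the orientation,
as needed to define a side in `exists_side`. -/
theorem odd_stateCycle_iff {d e : TDart C} :
    Odd ((K.stateCycle s d).1 e) ↔ e ∈ K.component s d := by
  constructor
  · intro h
    by_contra he
    rw [K.stateCycle_of_notMem s he] at h
    exact absurd h (by decide)
  · intro h
    rcases (K.mem_component_iff s).1 h with h | h
    · rw [K.stateCycle_of_sameCycle h]; decide
    · rw [K.stateCycle_flip s h]; decide

/-- A component away from the closing arc is null-homologous. -/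
theorem exists_boundary_eq_stateCycle {d : TDart C} (hd : IsKnotDart d)
    (hne : K.component s d ≠ K.longComponent s) :
    ∃ g : K.torus.Face → ℤ, ∀ e, (K.stateCycle s d).1 e =
      g (K.torus.faceOf e) - g (K.torus.faceOf (K.torus.flip e)) := by
  have hend : ∀ b i, (K.stateCycle s d).1 (Sum.inr b, i) = 0 := fun b i =>
    K.stateCycle_of_notMem s (K.endpoint_notMem_component s hd hne b i)
  obtain ⟨k, g, hg⟩ := K.exists_eq_meridian_add_boundary (K.stateCycle s d) (hend _ _)
  have htail := K.eq_at_tail_of_eq_along_longComponent s (g := fun x => (g x : ℚ))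
    (fun e he => by
      have h1 := hg e
      have h2 := K.isKnotDart_of_mem_longComponent s he
      rw [K.stateCycle_of_notMem s (K.notMem_component_of_mem_longComponent s hne he),
        K.meridianCycle_of_ne (fun h => not_isKnotDart_one _ (h ▸ h2))
          (fun h => not_isKnotDart_three _ (h ▸ h2))] at h1
      have : g (K.torus.faceOf e) = g (K.torus.faceOf (K.torus.flip e)) := by linarith
      exact_mod_cast this)
    (by
      have h1 := hg (Sum.inr true, 1)
      rw [hend, K.meridianCycle_of_ne (by simp) (by simp), torus_flip_one] at h1
      have : g (K.torus.faceOf (Sum.inr true, 1)) = g (K.torus.faceOf (Sum.inr true, 3)) := by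
        linarith
      exact_mod_cast this)
  have hk : k = 0 := by
    have h1 := hg (Sum.inr false, 1)
    have h2 : g (K.torus.faceOf (Sum.inr false, 1)) = g (K.torus.faceOf (Sum.inr false, 3)) := by
      exact_mod_cast htail
    rw [hend, K.meridianCycle_one, torus_flip_one, h2] at h1
    linarith
  exact ⟨g, fun e => by rw [hg e, hk]; ring⟩

/-- A component away from the closing arc separates the torus into two sides, one of which does not
contain the square on the handle. -/
theorem exists_side {d : TDart C} (hd : IsKnotDart d)
    (hne : K.component s d ≠ K.longComponent s) :
    ∃ X : Set (K.stateMap s).Face,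
      (K.stateMap s).faceOf (Sum.inl (Sum.inr true, 2)) ∉ X ∧
      (∀ e, e ∈ Sum.inl '' K.component s d ↔
        ¬ ((K.stateMap s).faceOf e ∈ X ↔ (K.stateMap s).faceOf ((K.stateMap s).flip e) ∈ X)) ∧
      ∀ h : (K.stateMap s).Face → ℚ, (∀ e ∉ Sum.inl '' K.component s d,
        h ((K.stateMap s).faceOf e) = h ((K.stateMap s).faceOf ((K.stateMap s).flip e))) →
        ∀ x y, (x ∈ X ↔ y ∈ X) → h x = h y := by
  classical
  obtain ⟨g₀, hg₀⟩ := K.exists_boundary_eq_stateCycle s hd hne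
  have hcross := K.stateMap_faceOf_crossing s
  have hconst := fun h => K.stateMap_face_const s (α := ℚ) (h := h)
  have hflip : ∀ e, (K.stateMap s).flip (Sum.inl e) = Sum.inl (K.torus.flip e) := fun _ => rfl
  set N := K.stateMap s with hN
  let g : N.Face → ℤ := fun x => g₀ (K.stateFaceEquiv s x)
  have hg : ∀ e, g (N.faceOf (Sum.inl e)) - g (N.faceOf (N.flip (Sum.inl e))) =
      (K.stateCycle s d).1 e := fun e => (hg₀ e).symm
  have hinr : ∀ x, (Sum.inr x : Dart C) ∉ Sum.inl '' K.component s d := by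
    rintro x ⟨y, -, hy⟩
    exact absurd hy Sum.inl_ne_inr
  have hg' : ∀ x, g (N.faceOf (Sum.inr x)) = g (N.faceOf (N.flip (Sum.inr x))) := by
    rintro ⟨c, b⟩
    obtain ⟨h1, h2, h3⟩ := hcross c b
    have e1 := hg (Sum.inl c, s.base c b)
    have e2 := hg (Sum.inl c, s.base c b + 1)
    rw [← h1, h3] at e1
    rw [← h2, ← turn_base, stateCycle_turn, turn_base] at e2
    linarith
  set x₀ := N.faceOf (Sum.inl (Sum.inr true, 2)) with hx₀
  -- Parity of `g` changes exactly across the component; normalizing at the square `x₀` puts the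
  -- square outside `X`.
  let X : Set N.Face := {x | Odd (g x - g x₀)}
  have hX : ∀ x y, ¬ (x ∈ X ↔ y ∈ X) ↔ Odd (g x - g y) := by
    intro x y
    have : g x - g y = (g x - g x₀) - (g y - g x₀) := by ring
    rw [this, Int.odd_sub, ← Int.not_odd_iff_even]
    change ¬ (Odd _ ↔ Odd _) ↔ _
    tauto
  have hsep : ∀ e, e ∈ Sum.inl '' K.component s d ↔
        ¬ (N.faceOf e ∈ X ↔ N.faceOf (N.flip e) ∈ X) := by
    intro e
    rw [hX]
    rcases e with e | x
    · rw [hg, odd_stateCycle_iff, Set.mem_image]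
      simp
    · rw [hg', sub_self]
      exact ⟨fun h => absurd h (hinr x), fun h => absurd h (by decide)⟩
  -- The jump of `h` is carried along the component unchanged, so it is a multiple of the cycle of
  -- the component, whose 2-chain is `g`. Subtracting that multiple of `g` leaves a function without
  -- jumps.
  have hlin : ∀ h : N.Face → ℚ, (∀ e ∉ Sum.inl '' K.component s d,
      h (N.faceOf e) = h (N.faceOf (N.flip e))) → ∃ a b : ℚ, ∀ x, h x = a * g x + b := by
    intro h hh
    let z : TDart C → ℚ := fun e => h (N.faceOf (Sum.inl e)) - h (N.faceOf (N.flip (Sum.inl e)))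
    have hzf : ∀ e, z (K.torus.flip e) = - z e := fun e => by
      simp only [z, ← hflip, CombMap.flip_flip]; ring
    have hz0 : ∀ e ∉ K.component s d, z e = 0 := fun e he =>
      sub_eq_zero.2 (hh _ (fun ⟨x, hx, hxe⟩ => he (Sum.inl_injective hxe ▸ hx)))
    have hzt : ∀ e, z (s.turn e) = - z e := by
      have key : ∀ c b, z (Sum.inl c, s.base c b) = - z (Sum.inl c, s.base c b + 1) := by
        intro c b
        obtain ⟨h1, h2, h3⟩ := hcross c b
        have h4 := hh _ (hinr (c, b))
        simp only [z]
        rw [← h1, ← h2, h3, ← h4]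
        ring
      rintro ⟨c | b, i⟩
      · obtain ⟨b, rfl | rfl⟩ := s.eq_base c i
        · rw [turn_base, key, neg_neg]
        · rw [turn_base_add_one, key]
      · rw [turn_endpoint, hz0 _ (K.endpoint_notMem_component s hd hne b _),
          hz0 _ (K.endpoint_notMem_component s hd hne b _), neg_zero]
    have hzc : ∀ e, (s.turn * K.torus.flip).SameCycle d e → z e = z d := fun e he =>
      (he.map_eq (f := z) (fun x => by
        rw [Equiv.Perm.mul_apply, hzt, hzf, neg_neg])).symm
    have hzg : ∀ e, z e = z d * (K.stateCycle s d).1 e := by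
      intro e
      by_cases he : e ∈ K.component s d
      · rcases (K.mem_component_iff s).1 he with h1 | h1
        · rw [hzc e h1, K.stateCycle_of_sameCycle h1]; simp
        · rw [K.stateCycle_flip s h1, ← hzc _ h1, hzf]; simp
      · rw [hz0 e he, K.stateCycle_of_notMem s he]; simp
    refine ⟨z d, h x₀ - z d * g x₀, fun x => ?_⟩
    have := hconst (fun x => h x - z d * g x) (by
      rintro (e | x)
      · have h1 := hzg e
        rw [← hg] at h1
        simp only [z] at h1 ⊢
        push_cast at h1
        linarith
      · rw [hg', hh _ (hinr x)]) x x₀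
    linarith
  refine ⟨X, by simp [X], hsep, fun h hh x y hxy => ?_⟩
  -- The indicator of `X` is itself affine in `g`, with nonzero slope because `X` changes across
  -- `d`. So `g`, and with it every admissible `h`, depends only on the side.
  obtain ⟨a, b, hab⟩ := hlin (fun x => if x ∈ X then 1 else 0) (fun e he => by
    have := (hsep e).not.1 he
    rw [not_not] at this
    simp only [this])
  have hd1 := (hsep (Sum.inl d)).1 ⟨d, K.mem_component_self s d, rfl⟩
  have ha : a ≠ 0 := by
    rintro rfl
    refine hd1 ?_
    have h1 := hab (N.faceOf (Sum.inl d))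
    have h2 := hab (N.faceOf (N.flip (Sum.inl d)))
    rw [zero_mul] at h1 h2
    have h3 := h1.trans h2.symm
    split_ifs at h3 with h4 h5 h5
    · exact iff_of_true h4 h5
    · norm_num at h3
    · norm_num at h3
    · exact iff_of_false h4 h5
  have hgxy : (g x : ℚ) = g y := by
    have h1 := hab x
    have h2 := hab y
    simp only [hxy] at h1
    exact mul_left_cancel₀ ha (by linarith)
  obtain ⟨a', b', hab'⟩ := hlin h hh
  rw [hab', hab', hgxy]

end Homology

end KnotoidDiagram

/-! ### Cells inside and between two complementary sides -/

namespace CombMap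

variable {D : Type*} (M : CombMap D)

theorem edgeOf_mem_innerEdges_of_vertexOf_mem {X : Set M.Face} {d : D}
    (h : M.vertexOf d ∈ M.innerVertices X) : M.edgeOf d ∈ M.innerEdges X := by
  refine M.edgeOf_mem_innerEdges.2 ⟨h d rfl, ?_⟩
  rw [faceOf_flip]
  exact h _ (M.vertexOf_next d)

/-- If the two sides `X` and `Xᶜ` both have corners at a vertex, then they are separated by an edge
there. -/
theorem exists_separating_dart {X : Set M.Face} {d e : D} (hde : M.vertexOf d = M.vertexOf e)
    (hd : M.faceOf d ∈ X) (he : M.faceOf e ∉ X) :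
    ∃ a, M.vertexOf a = M.vertexOf d ∧ ¬ (M.faceOf a ∈ X ↔ M.faceOf (M.flip a) ∈ X) := by
  by_contra! hcon
  have hsame : M.next.SameCycle d e := Quotient.exact hde
  -- The proposition itself is transported around the vertex; the vertex condition is built in
  -- because `hcon` is known only there.
  have := hsame.map_eq (f := fun a => M.vertexOf a = M.vertexOf d → M.faceOf a ∈ X) (fun a => by
    rw [vertexOf_next, faceOf_next]
    exact propext (forall_congr' fun ha => (hcon a ha).symm))
  exact he ((this ▸ fun _ => hd : M.vertexOf e = M.vertexOf d → M.faceOf e ∈ X) hde.symm)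

/-- The vertices and edges on the common boundary of the two sides `X` and `Xᶜ`, counted together
with those inside. -/
theorem card_innerVertices_add [Finite D] (X : Set M.Face) (O : Set D)
    (hO : ∀ a ∈ O, ¬ (M.faceOf a ∈ X ↔ M.faceOf (M.flip a) ∈ X))
    (hv : ∀ a, ¬ (M.faceOf a ∈ X ↔ M.faceOf (M.flip a) ∈ X) →
      ∃ b ∈ O, M.vertexOf b = M.vertexOf a)
    (hinj : Set.InjOn M.vertexOf O) :
    Nat.card (M.innerVertices X) + Nat.card (M.innerVertices Xᶜ) + O.ncard =
      Nat.card M.Vertex := by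
  have h1 : M.vertexOf '' O = (M.innerVertices X ∪ M.innerVertices Xᶜ)ᶜ := by
    ext v
    constructor
    · rintro ⟨a, ha, rfl⟩ h
      refine hO a ha ?_
      rcases h with h | h
      · exact iff_of_true (h a rfl) (M.faceOf_flip a ▸ h _ (M.vertexOf_next a))
      · exact iff_of_false (h a rfl) (M.faceOf_flip a ▸ h _ (M.vertexOf_next a))
    · intro h
      rw [Set.mem_compl_iff, Set.mem_union, not_or] at h
      obtain ⟨hX, hY⟩ := h
      simp only [innerVertices, Set.mem_ofPred_eq, not_forall, Set.mem_compl_iff, not_not] at hX hY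
      obtain ⟨e, he, he'⟩ := hX
      obtain ⟨d, hd, hd'⟩ := hY
      obtain ⟨a, ha, ha'⟩ := M.exists_separating_dart (hd.trans he.symm) hd' he'
      obtain ⟨b, hb, hb'⟩ := hv a ha'
      exact ⟨b, hb, hb'.trans (ha.trans hd)⟩
  have hdisj : Disjoint (M.innerVertices X) (M.innerVertices Xᶜ) := by
    rw [Set.disjoint_left]
    rintro ⟨d⟩ h h'
    exact h' d rfl (h d rfl)
  have h2 := Set.ncard_add_ncard_compl (M.innerVertices X ∪ M.innerVertices Xᶜ)
  rw [← h1, hinj.ncard_image, Set.ncard_union_eq hdisj] at h2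
  exact h2

theorem card_innerEdges_add [Finite D] (X : Set M.Face) (O : Set D)
    (hO : ∀ a ∈ O, ¬ (M.faceOf a ∈ X ↔ M.faceOf (M.flip a) ∈ X))
    (hO' : ∀ a, ¬ (M.faceOf a ∈ X ↔ M.faceOf (M.flip a) ∈ X) → a ∈ O ∨ M.flip a ∈ O)
    (hinj : ∀ a ∈ O, M.flip a ∉ O) :
    Nat.card (M.innerEdges X) + Nat.card (M.innerEdges Xᶜ) + O.ncard = Nat.card M.Edge := by
  have h1 : M.edgeOf '' O = (M.innerEdges X ∪ M.innerEdges Xᶜ)ᶜ := by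
    ext v
    constructor
    · rintro ⟨a, ha, rfl⟩ h
      rw [Set.mem_union, edgeOf_mem_innerEdges, edgeOf_mem_innerEdges] at h
      refine hO a ha ?_
      rcases h with h | h
      · exact iff_of_true h.1 h.2
      · exact iff_of_false h.1 h.2
    · obtain ⟨a, rfl⟩ := Quotient.exists_rep v
      intro h
      change M.edgeOf a ∈ _ at h
      rw [Set.mem_compl_iff, Set.mem_union, edgeOf_mem_innerEdges, edgeOf_mem_innerEdges] at h
      simp only [Set.mem_compl_iff] at h
      rcases hO' a (by tauto) with h2 | h2
      · exact ⟨a, h2, rfl⟩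
      · exact ⟨_, h2, M.edgeOf_flip a⟩
  have hdisj : Disjoint (M.innerEdges X) (M.innerEdges Xᶜ) := by
    rw [Set.disjoint_left]
    rintro ⟨d⟩ h h'
    exact h' d rfl (h d rfl)
  have hinj' : Set.InjOn M.edgeOf O := by
    intro a ha b hb hab
    rcases M.edgeOf_eq_iff.1 hab with h | h
    · exact h.symm
    · exact absurd (h ▸ hb) (hinj a ha)
  have h2 := Set.ncard_add_ncard_compl (M.innerEdges X ∪ M.innerEdges Xᶜ)
  rw [← h1, hinj'.ncard_image, Set.ncard_union_eq hdisj] at h2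
  exact h2

end CombMap

theorem Set.card_diff_singleton_add_one {α : Type*} [Finite α] {X : Set α} {x : α} (hx : x ∈ X) :
    Nat.card (X \ {x} : Set α) + 1 = Nat.card X := Set.ncard_sdiff_singleton_add_one hx

/-! ### The side away from the square is a disk -/

namespace KnotoidDiagram

open BracketState

variable {C : Type*} (K : KnotoidDiagram C) (s : BracketState C)

theorem label_turn (d : TDart C) : s.label (Sum.inl (s.turn d)) = s.label (Sum.inl d) := by
  obtain ⟨c | b, i⟩ := d
  · obtain ⟨b, rfl | rfl⟩ := s.eq_base c i
    · rw [turn_base, label_base, label_base_add_one]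
    · rw [turn_base_add_one, label_base, label_base_add_one]
  · rfl

/-- After smoothing only two old darts remain at a vertex of a crossing, so a state curve passes
there at most once. -/
theorem eq_or_eq_turn_of_label_eq {c : C} {i : ZMod 4} {e : TDart C}
    (h : s.label (Sum.inl e) = s.label (Sum.inl (Sum.inl c, i))) :
    e = (Sum.inl c, i) ∨ e = s.turn (Sum.inl c, i) := by
  obtain ⟨c' | b', i'⟩ := e
  · obtain ⟨b, rfl | rfl⟩ := s.eq_base c i <;> obtain ⟨b', rfl | rfl⟩ := s.eq_base c' i' <;>
    simp only [label_base, label_base_add_one, Sum.inl.injEq, Prod.mk.injEq] at h <;>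
    obtain ⟨rfl, rfl⟩ := h
    · exact Or.inl rfl
    · rw [turn_base]; exact Or.inr rfl
    · rw [turn_base_add_one]; exact Or.inr rfl
    · exact Or.inl rfl
  · exact absurd h Sum.inr_ne_inl

/-- The endpoints and the component of the closing arc lie on the side of the square. -/
theorem faceOf_notMem_side {d : TDart C} (hd : IsKnotDart d)
    (hne : K.component s d ≠ K.longComponent s) {X : Set (K.stateMap s).Face}
    (h0 : (K.stateMap s).faceOf (Sum.inl (Sum.inr true, 2)) ∉ X)
    (hX : ∀ e, e ∈ Sum.inl '' K.component s d ↔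
        ¬ ((K.stateMap s).faceOf e ∈ X ↔ (K.stateMap s).faceOf ((K.stateMap s).flip e) ∈ X)) :
    (∀ b i, (K.stateMap s).faceOf (Sum.inl (Sum.inr b, i)) ∉ X) ∧
      ∀ e ∈ K.longComponent s, (K.stateMap s).faceOf (Sum.inl e) ∉ X := by
  have hX' : ∀ e, e ∉ K.component s d → ((K.stateMap s).faceOf (Sum.inl e) ∈ X ↔
      (K.stateMap s).faceOf (Sum.inl (K.torus.flip e)) ∈ X) := by
    intro e he
    have := (hX (Sum.inl e)).not.1 (fun ⟨x, hx, hxe⟩ => he (Sum.inl_injective hxe ▸ hx))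
    rwa [not_not, stateMap_flip_inl] at this
  have heq : ∀ {x y : TDart C}, K.torus.faceOf x = K.torus.faceOf y →
      (K.stateMap s).faceOf (Sum.inl x) = (K.stateMap s).faceOf (Sum.inl y) := fun h =>
    (K.stateFaceEquiv s).injective h
  have hend : ∀ b i, (K.stateMap s).faceOf (Sum.inl (Sum.inr b, i)) ∉ X := by
    have h2 : ∀ b, (K.stateMap s).faceOf (Sum.inl (Sum.inr b, 2)) ∉ X := fun b => by
      rwa [heq ((K.torus_faceOf_two b).trans (K.torus_faceOf_two true).symm)]
    have h3 : ∀ b, (K.stateMap s).faceOf (Sum.inl (Sum.inr b, 3)) ∉ X := fun b => by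
      rw [heq (K.torus_faceOf_three b)]
      exact h2 false
    have h1 : ∀ b, (K.stateMap s).faceOf (Sum.inl (Sum.inr b, 1)) ∉ X := fun b => by
      rw [hX' _ (K.endpoint_notMem_component s hd hne b 1), torus_flip_one]
      exact h3 b
    intro b i
    have : ∀ i : ZMod 4, i = 0 ∨ i = 1 ∨ i = 2 ∨ i = 3 := by decide
    rcases this i with rfl | rfl | rfl | rfl
    · rw [heq (K.torus_faceOf_zero b)]; exact h1 b
    · exact h1 b
    · exact h2 b
    · exact h3 b
  refine ⟨hend, fun e he => K.component_induction s (Q := fun e =>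
    (K.stateMap s).faceOf (Sum.inl e) ∉ X) h0 (fun e he hQ => ?_) (fun e he hQ => ?_) he⟩
  · rwa [← hX' e (K.notMem_component_of_mem_longComponent s hne he)]
  · have het := K.turn_mem_component s he
    obtain ⟨c | b, i⟩ := e
    · obtain ⟨b, rfl | rfl⟩ := s.eq_base c i
      · rw [turn_base, heq (K.torus_faceOf_base_add_one s c b),
          ← hX' _ (K.notMem_component_of_mem_longComponent s hne he)]
        exact hQ
      · rw [turn_base_add_one] at het ⊢
        rw [hX' _ (K.notMem_component_of_mem_longComponent s hne het),
          ← heq (K.torus_faceOf_base_add_one s c b)]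
        exact hQ
    · exact hend _ _

section Card

variable [Fintype C]

/-- A 1-cycle of the torus that passes straight through the smoothings is a cycle of the smoothed
diagram. -/
theorem isClosed_elim_zero {z : TDart C → ℚ} (hz : ∀ e, z (s.turn e) = - z e) :
    (K.stateMap s).IsClosed (Sum.elim z 0) := by
  classical
  intro d
  -- This involution permutes the darts at each vertex and negates the chain, so the sum there
  -- equals its own negative.
  let t : Equiv.Perm (Dart C) := Equiv.sumCongr s.turn (Equiv.refl _)
  have h : ∑ e with (K.stateMap s).vertexOf e = (K.stateMap s).vertexOf d, Sum.elim z 0 e =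
      ∑ e with (K.stateMap s).vertexOf e = (K.stateMap s).vertexOf d, - Sum.elim z 0 e := by
    refine Finset.sum_equiv t (fun e => ?_) (fun e _ => ?_)
    · simp only [Finset.mem_filter, Finset.mem_univ, true_and, stateMap_vertexOf_eq_iff]
      rcases e with e | x
      · exact (label_turn s e).symm ▸ Iff.rfl
      · rfl
    · rcases e with e | x
      · change z e = - z (s.turn e)
        rw [hz, neg_neg]
      · change (0 : ℚ) = - 0
        rw [neg_zero]
  rw [Finset.sum_neg_distrib] at h
  have h' : ∑ e with (K.stateMap s).vertexOf e = (K.stateMap s).vertexOf d,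
    Sum.elim z 0 e = 0 := by linarith
  convert h'

/-- Neither side can be counted exactly on its own. The upper bounds 1 and -1 for the Euler
characteristics of `X` and `Xᶜ` are forced to be equalities because the total is zero. -/
theorem card_side {d : TDart C} (hd : IsKnotDart d)
    (hne : K.component s d ≠ K.longComponent s) {X : Set (K.stateMap s).Face}
    (h0 : (K.stateMap s).faceOf (Sum.inl (Sum.inr true, 2)) ∉ X)
    (hX : ∀ e, e ∈ Sum.inl '' K.component s d ↔
        ¬ ((K.stateMap s).faceOf e ∈ X ↔ (K.stateMap s).faceOf ((K.stateMap s).flip e) ∈ X))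
    (hconst : ∀ h : (K.stateMap s).Face → ℚ, (∀ e ∉ Sum.inl '' K.component s d,
        h ((K.stateMap s).faceOf e) = h ((K.stateMap s).faceOf ((K.stateMap s).flip e))) →
        ∀ x y, (x ∈ X ↔ y ∈ X) → h x = h y) :
    Nat.card ((K.stateMap s).innerVertices X) + Nat.card X =
      Nat.card ((K.stateMap s).innerEdges X) + 1 := by
  obtain ⟨hend, hlong⟩ := K.faceOf_notMem_side s hd hne h0 hX
  have hd1 := (hX (Sum.inl d)).1 ⟨d, K.mem_component_self s d, rfl⟩
  obtain ⟨e₁, he₁⟩ : ∃ e, (K.stateMap s).faceOf e ∈ X := by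
    by_contra! h
    exact hd1 (iff_of_false (h _) (h _))
  -- a 0-cochain without coboundary that vanishes somewhere is zero
  have hcob : ∀ (A : Set (K.stateMap s).Vertex) (e : Dart C), (K.stateMap s).vertexOf e ∉ A →
      ∀ f : (K.stateMap s).Vertex → ℚ, (∀ v ∉ A, f v = 0) → (K.stateMap s).cobdry f = 0 →
        f = 0 := by
    intro A e he f hf0 hf
    ext v
    obtain ⟨a, rfl⟩ := Quotient.exists_rep v
    refine (K.stateMap_const s (f := fun a => f ((K.stateMap s).vertexOf a))
      (fun a => by rw [CombMap.vertexOf_next]) (fun a => ?_) a e).trans (hf0 _ he)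
    have := congrFun hf a
    rw [CombMap.cobdry_apply] at this
    exact (sub_eq_zero.1 this).symm
  -- a 2-chain on one side without boundary there is constant
  have hbd : ∀ (Z : Set (K.stateMap s).Face), (Z = X ∨ Z = Xᶜ) → ∀ x ∈ Z,
      ∀ g : (K.stateMap s).Face → ℚ, (∀ y ∉ Z \ {x}, g y = 0) →
      (∀ e, (K.stateMap s).edgeOf e ∈ (K.stateMap s).innerEdges Z →
        (K.stateMap s).bdry g e = 0) → g = 0 := by
    intro Z hZ x hx g hg0 hg
    have hZX : ∀ y, y ∈ Z → (x ∈ X ↔ y ∈ X) := by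
      intro y hy
      rcases hZ with rfl | rfl
      · exact iff_of_true hx hy
      · exact iff_of_false hx hy
    have key := hconst g (fun e he => by
      have h1 := (hX e).not.1 he
      rw [not_not] at h1
      have h2 : (K.stateMap s).faceOf e ∈ Z ↔
          (K.stateMap s).faceOf ((K.stateMap s).flip e) ∈ Z := by
        rcases hZ with rfl | rfl
        · exact h1
        · exact not_congr h1
      by_cases h3 : (K.stateMap s).faceOf e ∈ Z
      · exact sub_eq_zero.1 (hg e (CombMap.edgeOf_mem_innerEdges _ |>.2 ⟨h3, h2.1 h3⟩))
      · rw [hg0 _ (fun h => h3 h.1), hg0 _ (fun h => h3 (h2.2 h.1))])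
    ext y
    by_cases hy : y ∈ Z
    · rw [← key x y (hZX y hy)]
      exact hg0 x (by simp)
    · exact hg0 y (fun h => hy h.1)
  -- Euler characteristic at most 1 for `X`: one face is left out and no cycles are added.
  have hcardX := (CombMap.card_add_card_le (M := K.stateMap s) (n := 0)
    (E := (K.stateMap s).innerEdges X) (A := (K.stateMap s).innerVertices X)
    (B := X \ {(K.stateMap s).faceOf e₁}) (c := fun i => i.elim0)
    (fun _ h => CombMap.edgeOf_mem_innerEdges_of_vertexOf_mem _ h)
    (fun i => i.elim0) (fun i => i.elim0)
    (hcob _ (Sum.inl (Sum.inr true, 2)) (fun h => h0 (h _ rfl)))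
    (fun g a hg0 hg => ⟨hbd X (Or.inl rfl) _ he₁ g hg0 (fun e he => by simpa using hg e he),
      Subsingleton.elim _ _⟩)).1
  set mer : TDart C → ℚ := fun e => (K.meridianCycle.1 e : ℚ) with hmer
  set lon : TDart C → ℚ := fun e => ((K.stateCycle s (Sum.inr true, 2)).1 e : ℚ) with hlon
  have hmerk : ∀ e, IsKnotDart e → mer e = 0 := fun e he => by
    simp only [hmer]
    rw [K.meridianCycle_of_ne (fun h => not_isKnotDart_one _ (h ▸ he))
          (fun h => not_isKnotDart_three _ (h ▸ he))]
    rfl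
  have hmer0 : ∀ c i, mer (Sum.inl c, i) = 0 := fun c i => hmerk _ trivial
  have hmert : ∀ e, mer (s.turn e) = - mer e := by
    rintro ⟨c | b, i⟩
    · rw [hmer0, neg_zero]
      exact hmer0 _ _
    · have : ∀ i : ZMod 4, (i = 0 ∨ i = 2) ∨ i = 1 ∨ i = 3 := by decide
      rcases this i with h | h
      · rw [hmerk _ (isKnotDart_turn s (show IsKnotDart (Sum.inr b, i) from h)),
          hmerk (Sum.inr b, i) h, neg_zero]
      · have hturn : s.turn (Sum.inr b, i) = K.torus.flip (Sum.inr b, i) := by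
          rcases h with rfl | rfl
          · rw [torus_flip_one]; rfl
          · rw [torus_flip_three]; rfl
        rw [hturn]
        exact (CombMap.cast_mem_chains K.meridianCycle).1 _
  have hlont : ∀ e, lon (s.turn e) = - lon e := fun e => by
    simp only [hlon, stateCycle_turn, Int.cast_neg]
  have hchain : ∀ z : K.torus.cycles, (∀ e, z.1 e ≠ 0 → (K.stateMap s).faceOf (Sum.inl e) ∉ X) →
      Sum.elim (fun e => (z.1 e : ℚ)) 0 ∈
        (K.stateMap s).chains ((K.stateMap s).innerEdges Xᶜ) := by
    intro z hz
    refine ⟨?_, ?_⟩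
    · rintro (e | x)
      · exact (CombMap.cast_mem_chains z).1 e
      · change (0 : ℚ) = - 0
        rw [neg_zero]
    · rintro (e | x) he
      · by_contra h
        have h1 : z.1 e ≠ 0 := fun h' => h (by simp [h'])
        refine he (CombMap.edgeOf_mem_innerEdges _ |>.2 ⟨hz e h1, hz (K.torus.flip e) ?_⟩)
        rwa [CombMap.cycles_flip, neg_ne_zero]
      · rfl
  -- Euler characteristic at most -1 for `Xᶜ`: the meridian and the long component lie inside this
  -- side and are independent there modulo boundaries.
  have hcardY := (CombMap.card_add_card_le (M := K.stateMap s) (n := 2)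
    (E := (K.stateMap s).innerEdges Xᶜ) (A := (K.stateMap s).innerVertices Xᶜ)
    (B := Xᶜ \ {(K.stateMap s).faceOf (Sum.inl (Sum.inr true, 2))})
    (c := ![Sum.elim mer 0, Sum.elim lon 0])
    (fun _ h => CombMap.edgeOf_mem_innerEdges_of_vertexOf_mem _ h)
    (fun i => by
      fin_cases i
      · refine hchain _ fun e he => ?_
        obtain ⟨c | b, i⟩ := e
        · refine absurd ?_ he
          exact Int.cast_eq_zero.1 (hmer0 c i)
        · exact hend b i
      · refine hchain _ fun e he => hlong e ?_
        by_contra h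
        exact he (K.stateCycle_of_notMem s h))
    (fun i => by
      fin_cases i
      · exact K.isClosed_elim_zero s hmert
      · exact K.isClosed_elim_zero s hlont)
    (hcob _ e₁ (fun h => h _ rfl he₁))
    (fun g a hg0 hg => by
      have hg' : ∀ e, (K.stateMap s).faceOf (Sum.inl e) ∉ X →
          (K.stateMap s).faceOf (Sum.inl (K.torus.flip e)) ∉ X →
          g ((K.stateMap s).faceOf (Sum.inl e)) -
            g ((K.stateMap s).faceOf (Sum.inl (K.torus.flip e))) +
            (a 0 * mer e + a 1 * lon e) = 0 := fun e h1 h2 => by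
        have h3 := hg (Sum.inl e) (CombMap.edgeOf_mem_innerEdges _ |>.2 ⟨h1, h2⟩)
        rw [Fin.sum_univ_two] at h3
        exact h3
      have hclos : (K.stateMap s).faceOf (Sum.inl (Sum.inr true, 2)) =
          (K.stateMap s).faceOf (Sum.inl (K.torus.flip (Sum.inr true, 2))) :=
        (K.stateFaceEquiv s).injective (K.torus_faceOf_closing true)
      have ha1 : a 1 = 0 := by
        have h1 := hg' (Sum.inr true, 2) h0 (hclos ▸ h0)
        rw [← hclos, sub_self, hmerk _ (show IsKnotDart (Sum.inr true, 2) from Or.inr rfl)] at h1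
        simp only [hlon, K.stateCycle_of_sameCycle (Equiv.Perm.SameCycle.refl _ _)] at h1
        push_cast at h1
        linarith
      -- The relation is known only on the edges inside `Xᶜ`, but these include the long component
      -- and both attaching circles, which is all that the walk needs.
      have htail := K.eq_at_tail_of_eq_along_longComponent s
        (g := fun x => g ((K.stateFaceEquiv s).symm x)) (fun e he => by
          have h1 := hg' e (hlong e he) (hlong _ (K.flip_mem_component s he))
          rw [ha1, hmerk _ (K.isKnotDart_of_mem_longComponent s he)] at h1
          change g ((K.stateMap s).faceOf (Sum.inl e)) =
            g ((K.stateMap s).faceOf (Sum.inl (K.torus.flip e)))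
          linarith) (by
          have h1 := hg' (Sum.inr true, 1) (hend _ _) (by rw [torus_flip_one]; exact hend _ _)
          rw [ha1, torus_flip_one, hmer] at h1
          simp only [K.meridianCycle_of_ne (d := (Sum.inr true, 1)) (by simp) (by simp)] at h1
          change g ((K.stateMap s).faceOf (Sum.inl (Sum.inr true, 1))) =
            g ((K.stateMap s).faceOf (Sum.inl (Sum.inr true, 3)))
          push_cast at h1
          linarith)
      change g ((K.stateMap s).faceOf (Sum.inl (Sum.inr false, 1))) =
            g ((K.stateMap s).faceOf (Sum.inl (Sum.inr false, 3))) at htail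
      have ha0 : a 0 = 0 := by
        have h1 := hg' (Sum.inr false, 1) (hend _ _) (by rw [torus_flip_one]; exact hend _ _)
        rw [ha1, torus_flip_one, hmer, htail] at h1
        simp only [K.meridianCycle_one] at h1
        push_cast at h1
        linarith
      refine ⟨hbd Xᶜ (Or.inr rfl) _ h0 g hg0 (fun e he => ?_), ?_⟩
      · have := hg e he
        simpa [Fin.sum_univ_two, ha0, ha1] using this
      · ext i
        fin_cases i
        · exact ha0
        · exact ha1)).1
  -- One orientation of the component: it has one dart for each edge and one for each vertex of the
  -- separating circle, so these cancel in the Euler characteristic.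
  let O : Set (Dart C) := Sum.inl '' {e | (s.turn * K.torus.flip).SameCycle d e}
  have hOmem : ∀ e, (Sum.inl e : Dart C) ∈ O ↔ (s.turn * K.torus.flip).SameCycle d e := fun e => by
    simp [O]
  have hOX : ∀ a ∈ O, ¬ ((K.stateMap s).faceOf a ∈ X ↔
      (K.stateMap s).faceOf ((K.stateMap s).flip a) ∈ X) := by
    rintro _ ⟨e, he, rfl⟩
    exact (hX _).1 ⟨e, (K.mem_component_iff s).2 (Or.inl he), rfl⟩
  have hno : ∀ e, (s.turn * K.torus.flip).SameCycle d e →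
      ¬ (s.turn * K.torus.flip).SameCycle d (K.torus.flip e) := fun e he he' =>
    K.not_sameCycle_flip s e (he.symm.trans he')
  have hV := (K.stateMap s).card_innerVertices_add X O hOX (fun a ha => by
      obtain ⟨e, he, rfl⟩ := (hX a).2 ha
      rcases (K.mem_component_iff s).1 he with h | h
      · exact ⟨_, (hOmem e).2 h, rfl⟩
      · refine ⟨Sum.inl (s.turn e), (hOmem _).2 ((K.sameCycle_turn_iff s).2 h), ?_⟩
        rw [stateMap_vertexOf_eq_iff, label_turn]) (by
      rintro _ ⟨e, he, rfl⟩ _ ⟨e', he', rfl⟩ h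
      rw [stateMap_vertexOf_eq_iff] at h
      obtain ⟨c | b, i⟩ := e
      · rcases eq_or_eq_turn_of_label_eq s h.symm with rfl | rfl
        · rfl
        · exact absurd ((K.sameCycle_turn_iff s).1 he') (hno _ he)
      · exact absurd ((K.mem_component_iff s).2 (Or.inl he))
          (K.endpoint_notMem_component s hd hne b i))
  have hE := (K.stateMap s).card_innerEdges_add X O hOX (fun a ha => by
      obtain ⟨e, he, rfl⟩ := (hX a).2 ha
      rw [stateMap_flip_inl, hOmem, hOmem]
      exact (K.mem_component_iff s).1 he) (by
      rintro _ ⟨e, he, rfl⟩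
      rw [stateMap_flip_inl, hOmem]
      exact hno e he)
  have hF : Nat.card X + Nat.card (Xᶜ : Set _) = Nat.card (K.stateMap s).Face :=
    Set.ncard_add_ncard_compl X
  have hFX := Set.card_diff_singleton_add_one he₁
  have hFY := Set.card_diff_singleton_add_one (X := Xᶜ) h0
  rw [card_state_vertex] at hV
  rw [card_state_edge] at hE
  rw [card_state_face] at hF
  omega

/-- Every component other than the one of the closing arc bounds a disk. -/
theorem component_boundsDisk {d : TDart C} (hd : IsKnotDart d)
    (hne : K.component s d ≠ K.longComponent s) :
    K.ComponentBoundsDisk s (K.component s d) := by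
  classical
  obtain ⟨X, h0, hX, hconst⟩ := K.exists_side s hd hne
  refine ⟨X, hX, fun x hx y hy => ?_, ?_⟩
  · set R : (K.stateMap s).Face → (K.stateMap s).Face → Prop := fun a b =>
      ∃ d, (K.stateMap s).faceOf d = a ∧ (K.stateMap s).faceOf ((K.stateMap s).flip d) = b ∧
        a ∈ X ∧ b ∈ X with hR
    have hsub : ∀ z, Relation.ReflTransGen R x z → z ∈ X := by
      intro z hz
      rcases hz.cases_tail with rfl | ⟨w, -, -, -, -, -, h⟩
      · exact hx
      · exact h
    have hstep : ∀ e, e ∉ Sum.inl '' K.component s d →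
        Relation.ReflTransGen R x ((K.stateMap s).faceOf e) →
        Relation.ReflTransGen R x ((K.stateMap s).faceOf ((K.stateMap s).flip e)) := by
      intro e he h
      have h1 := (hX e).not.1 he
      rw [not_not] at h1
      exact h.tail ⟨e, rfl, rfl, hsub _ h, h1.1 (hsub _ h)⟩
    have hflip : ∀ e, e ∉ Sum.inl '' K.component s d →
        (K.stateMap s).flip e ∉ Sum.inl '' K.component s d := by
      intro e he
      rw [hX, CombMap.flip_flip, iff_comm]
      rwa [hX] at he
    -- The set of faces reachable from `x` changes across no edge off the component, so its
    -- indicator is constant on `X`; this is the connectedness of the side.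
    have h1 := hconst (fun z => if Relation.ReflTransGen R x z then 1 else 0) (fun e he => by
      have : Relation.ReflTransGen R x ((K.stateMap s).faceOf e) ↔
          Relation.ReflTransGen R x ((K.stateMap s).faceOf ((K.stateMap s).flip e)) := by
        refine ⟨hstep e he, fun h => ?_⟩
        have := hstep _ (hflip e he) h
        rwa [CombMap.flip_flip] at this
      simp only [this]) x y (iff_of_true hx hy)
    by_contra h
    simp only [if_neg h, if_pos Relation.ReflTransGen.refl] at h1
    norm_num at h1
  · have h := K.card_side s hd hne h0 hX hconst
    change (Nat.card ((K.stateMap s).innerVertices X) : ℤ) -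
      (Nat.card ((K.stateMap s).innerEdges X) : ℤ) + (Nat.card X : ℤ) = 1
    omega

theorem eq_longComponent_of_not_boundsDisk {S : Set (TDart C)} (hS : S ∈ K.stateComponents s)
    (h : ¬ K.ComponentBoundsDisk s S) : S = K.longComponent s := by
  obtain ⟨d, hd, rfl⟩ := hS
  by_contra hne
  exact h (K.component_boundsDisk s hd hne)

theorem multiplicityOne : K.MultiplicityOne s :=
  ⟨K.longComponent s, ⟨⟨(Sum.inr true, 2), Or.inr rfl, rfl⟩, K.longComponent_not_boundsDisk s⟩,
    fun _ h => K.eq_longComponent_of_not_boundsDisk s h.1 h.2⟩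

end Card

end KnotoidDiagram

/-! ### The theorem -/

theorem mainTheorem7 {C : Type*} [Fintype C] (K : KnotoidDiagram C) :
    (∃ lam : K.torus.H1, K.IsLongitude lam) ∧
    ∀ lam : K.torus.H1, K.IsLongitude lam →
      (LinearIndependent ℤ ![lam, K.meridian] ∧
        Submodule.span ℤ {lam, K.meridian} = ⊤) ∧
      ∀ s : BracketState C, K.HomologicallyNontrivial s →
        K.MultiplicityOne s ∧
        ∀ S ∈ K.stateComponents s, ¬ K.ComponentBoundsDisk s S →
          ∃ d ∈ S, ∃ k : ℤ, K.componentClass s d = lam + k • K.meridian := by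
  refine ⟨⟨_, K.isLongitude_stateCycle fun _ => true⟩, fun lam hlam =>
    ⟨K.longitude_meridian_basis hlam, fun s _ => ⟨K.multiplicityOne s, fun S hS hSd => ?_⟩⟩⟩
  obtain ⟨l, rfl, hl⟩ := hlam
  rw [K.eq_longComponent_of_not_boundsDisk s hS hSd]
  -- Starting at the head along the closing arc orients the component from head to tail on the
  -- handle, so its coefficient 1 there agrees with that of the longitude.
  refine ⟨(Sum.inr true, 2), K.mem_component_self s _, ?_⟩
  exact K.exists_eq_add_smul_meridian (z := K.stateCycle s (Sum.inr true, 2))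
    ((K.stateCycle_of_sameCycle (Equiv.Perm.SameCycle.refl _ _)).trans hl.symm)
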